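/- Let $\Gamma$ be a group with a finite symmetric generating set $\mathcal S$, $e\notin\mathcal S$, $|\mathcal S|=d\ge 3$, such that the Cayley graph (with an edge between $x$ and $y$ if and only if $yx^{-1}\in\mathcal S$) is a tree, i.e. the infinite $d$-regular tree. Let $(g_n)_{n\ge1}$ be the steps of the elephant random walk with memory parameter $p\in[0,1)$: $g_1$ is uniform on $\mathcal S$ and, given $g_1,\dots,g_n$, one draws $D$ uniformly from $\{1,\dots,n\}$ and sets $g_{n+1}=g_D$ with probability $p$ and $g_{n+1}=a$ with probability $\frac{1-p}{d-1}$ for each $a\in\mathcal S\setminus\{g_D\}$. Let $\Delta_n$ be the distance from $e$ to $w_n=g_n\cdots g_1$ in the word metric. Put $p_d=\frac{d+1}{2d}$ and $$r_n=\begin{cases} n^{1/2} & \text{if } p<p_d,\\ (n/\log n)^{1/2} & \text{if } p=p_d,\\ n^{d(1-p)/(d-1)} & \text{if } p>p_d.\end{cases}$$ Write $A_n\lesssim B_n$, or $B_n\gtrsim A_n$, if there is a constant $C>0$ not depending on $n$ (it may depend on $p$, $m$, $d$ and $(\Gamma,\mathcal S)$) such that $A_n\le CB_n$ for all $n\ge1$,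 except that only $n\ge2$ is required when $B_n$ involves $\log n$. Upper bounds. Let $p\in[0,1)$. For every $m\in[1,2)$, $$\mathbb E\Big|\frac{\Delta_n}{n}-\frac{d-2}{d}\Big|^m\lesssim r_n^{-m},$$ and for $m=2$, $$\mathbb E\Big|\frac{\Delta_n}{n}-\frac{d-2}{d}\Big|^2\lesssim\begin{cases} r_n^{-2}\log n & \text{if } p\le p_d,\\ r_n^{-2} & \text{if } p>p_d.\end{cases}$$ Lower bound. For every $m\in[1,2)$ there is $\epsilon>0$, with $(1/d-\epsilon,1/d+\epsilon)\subset[0,p_d)$, such that for all $p\in(1/d-\epsilon,1/d+\epsilon)$, $$\mathbb E\Big|\frac{\Delta_n}{n}-\frac{d-2}{d}\Big|^m\gtrsim n^{-m/2}.$$ -/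

import Mathlib

open MeasureTheory

universe u v

namespace ElephantWalk

noncomputable section

variable {Γ : Type*} [Group Γ]

/-- The (left) Cayley graph of a group with respect to `S`: `x` and `y ≠ x` are joined when
`y * x⁻¹ ∈ S` or `x * y⁻¹ ∈ S` (one condition when `S` is symmetric). -/
def cayleyGraph (S : Finset Γ) : SimpleGraph Γ :=
  SimpleGraph.fromRel fun x y => y * x⁻¹ ∈ S

/-- `S` is a finite symmetric generating set of `Γ`, without the identity, whose Cayley graph is a
tree. Every vertex `x` then has exactly `S.card` neighbours, the elements `s * x` with `s ∈ S`, so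
the Cayley graph is the infinite regular tree of degree `S.card` when `2 ≤ S.card`. -/
structure IsTreeGenerating (S : Finset Γ) : Prop where
  one_notMem : (1 : Γ) ∉ S
  inv_mem : ∀ s ∈ S, s⁻¹ ∈ S
  closure_eq_top : Subgroup.closure (S : Set Γ) = ⊤
  isTree : (cayleyGraph S).IsTree

theorem cayleyGraph_adj {S : Finset Γ} (hS : IsTreeGenerating S) (x y : Γ) :
    (cayleyGraph S).Adj x y ↔ y * x⁻¹ ∈ S := by
  simp only [cayleyGraph, SimpleGraph.fromRel_adj]
  constructor
  · rintro ⟨-, h | h⟩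
    · exact h
    · simpa using hS.inv_mem _ h
  · refine fun h => ⟨?_, Or.inl h⟩
    rintro rfl
    exact hS.one_notMem (by simpa using h)

/-- The position `w_n = g_n ⋯ g_1` (with `w_0 = e`) after the steps `g_1, …, g_n`. -/
def position {S : Finset Γ} (g : ℕ → S) : ℕ → Γ
  | 0 => 1
  | n + 1 => (g (n + 1) : Γ) * position g n

/-- `Δ_n`: the distance from the identity, in the word metric, after `n` steps. -/
def height {S : Finset Γ} (g : ℕ → S) (n : ℕ) : ℕ :=
  (cayleyGraph S).dist (position g n) 1

open Classical in
/-- The probability that the next step is `a`, when the recalled step is `b`: the recalled step is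
repeated with probability `p`, and each of the other elements of `S` is chosen with probability
`(1 - p) / (d - 1)`, where `d = S.card`. -/
def recallProb (S : Finset Γ) (p : ℝ) (b a : S) : ℝ :=
  if a = b then p else (1 - p) / ((S.card : ℝ) - 1)

/-- The conditional probability that step `n + 1` is `a`, given the past steps `s 1, …, s n`: a
uniformly random time `D` in `{1, …, n}` is drawn, and the step `s D` is recalled. -/
def nextStepProb (S : Finset Γ) (p : ℝ) (n : ℕ) (s : ℕ → S) (a : S) : ℝ :=
  ∑ D ∈ Finset.Icc 1 n, (1 / (n : ℝ)) * recallProb S p (s D) a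

/-- The random variables `g 1, g 2, …` on the probability space `(Ω, P)` are the steps of an
elephant random walk on the Cayley graph of `S`, with memory parameter `p`: the first step is
uniform on `S`, and the law of step `n + 1` given the past is `nextStepProb`.
(The value `g 0` plays no role.) -/
structure IsElephantWalk {Ω : Type*} [MeasurableSpace Ω] (S : Finset Γ) (p : ℝ) (P : Measure Ω)
    (g : ℕ → Ω → S) : Prop where
  measurable_step : ∀ n, 1 ≤ n → ∀ a : S, MeasurableSet {ω | g n ω = a}
  first_step : ∀ a : S, P.real {ω | g 1 ω = a} = 1 / (S.card : ℝ)
  next_step : ∀ n, 1 ≤ n → ∀ (s : ℕ → S) (a : S),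
    P.real {ω | (∀ k, 1 ≤ k → k ≤ n → g k ω = s k) ∧ g (n + 1) ω = a} =
      P.real {ω | ∀ k, 1 ≤ k → k ≤ n → g k ω = s k} * nextStepProb S p n s a

/-- `𝔼 |Δ_n / n - (d - 2) / d| ^ m`, where `d = S.card`. -/
def speedErrorMoment {Ω : Type*} [MeasurableSpace Ω] {S : Finset Γ} (P : Measure Ω)
    (g : ℕ → Ω → S) (m : ℝ) (n : ℕ) : ℝ :=
  ∫ ω, |(height (fun k => g k ω) n : ℝ) / n - ((S.card : ℝ) - 2) / S.card| ^ m ∂P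

/-- The critical memory parameter `p_d = (d + 1) / (2 d)`. -/
def criticalParam (d : ℕ) : ℝ := ((d : ℝ) + 1) / (2 * d)

/-- The rate `r_n(p, d)`. -/
def rate (d : ℕ) (p : ℝ) (n : ℕ) : ℝ :=
  if p < criticalParam d then (n : ℝ) ^ (1 / 2 : ℝ)
  else if p = criticalParam d then ((n : ℝ) / Real.log n) ^ (1 / 2 : ℝ)
  else (n : ℝ) ^ ((d : ℝ) * (1 - p) / ((d : ℝ) - 1))

end

end ElephantWalk

open ElephantWalk

/-!
The proof rests on an exact description of the next step. With `Y_a(n) = #{k ≤ n | g_k = a} - n / d`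
and `α = (p d - 1) / (d - 1)`, the conditional probability that step `n + 1` is `a` equals
`1 / d + α Y_a(n) / n` (`nextStepProb_eq_stepProb`); the three regimes are `α < 1 / 2`, `α = 1 / 2`
and `α > 1 / 2`. Hence `𝔼 Y_a(n + 1)² ≤ (1 + 2 α / n) 𝔼 Y_a(n)² + 1`, and this recursion gives bounds
of order `n`, `n log n` and `n ^ (2 α)`, that is, of order `(n / r_n)²`.

*Upper bounds.* In the tree each vertex other than the identity has a unique neighbour closer to the
identity, so the height moves by `1 - 2 · 1{g_{n+1} = b}`, where `b` is the backward generator at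
`w_n`. For `D_n = Δ_n - n (d - 2) / d` this gives
`𝔼 D_{n+1}² ≤ 𝔼 D_n² - 4 α 𝔼 [D_n Y_b(n) / n] + 4`. Visits to the identity need no estimate: there the
height is pushed up while `D_n ≤ 0`, which only decreases the square (`sq_heightDev_succ_le`).
Splitting the product with suitable weights gives a linear recursion for `𝔼 D_n²` driven by
`∑ a, 𝔼 Y_a(n)² / n`, so that `𝔼 D_n²` is again of order `(n / r_n)²`
(`IsElephantWalk.expect_sq_heightDev_le`). Moments of lower order follow by Jensen's inequality.

*Lower bound.* The martingale part `M_n` of `∑ k < n, (1 - 2 · 1{g_{k+1} = b_k})` has conditional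
variances between `1 / d` and `1` when `α` is small, so `𝔼 M_n²` is at least of order `n` and `𝔼 M_n⁴`
at most of order `n²`; hence `𝔼 |M_n|` is at least of order `√n`. As visits to the identity only push
the walk up, `D_n ≥ M_n - 2 |α| T_n` with `T_n = ∑ k < n, |Y_{b_k}(k)| / k`, whose mean is `O(√n)`.
Since `M_n` is centred, `𝔼 |D_n| ≥ 𝔼 |M_n| / 2 - 2 |α| 𝔼 T_n`, which is at least of order `√n` once `α`
is small, that is, once `p` is close to `1 / d`. Moments of higher order follow by Jensen's
inequality.
-/

namespace ElephantWalk

noncomputable section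

/-! ### The backward generator in a Cayley tree -/

section Tree

variable {Γ : Type*} [Group Γ] {S : Finset Γ}

theorem dist_mul_eq_or (hS : IsTreeGenerating S) (x : Γ) (a : S) :
    (cayleyGraph S).dist (a * x) 1 = (cayleyGraph S).dist x 1 + 1 ∨
      (cayleyGraph S).dist x 1 = (cayleyGraph S).dist (a * x) 1 + 1 := by
  have hadj : (cayleyGraph S).Adj x (a * x) := by
    rw [cayleyGraph_adj hS]; simp
  have := hS.isTree.dist_eq_dist_add_one_of_adj 1 hadj
  rw [(cayleyGraph S).dist_comm (u := 1) (v := x),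
    (cayleyGraph S).dist_comm (u := 1) (v := a * x)] at this
  tauto

/-- In a tree, two neighbours of `x` that are both closer to the root coincide: prepending `x` to
geodesics from them gives two paths from `x` to the root. -/
theorem eq_of_dist_lt (hS : IsTreeGenerating S) {x : Γ} {a b : S}
    (ha : (cayleyGraph S).dist x 1 = (cayleyGraph S).dist (a * x) 1 + 1)
    (hb : (cayleyGraph S).dist x 1 = (cayleyGraph S).dist (b * x) 1 + 1) : a = b := by
  have key : ∀ c : S, (cayleyGraph S).dist x 1 = (cayleyGraph S).dist (c * x) 1 + 1 →
      ∃ w : (cayleyGraph S).Walk x 1, w.IsPath ∧ w.snd = c * x := by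
    intro c hc
    have hadj : (cayleyGraph S).Adj x (c * x) := by
      rw [cayleyGraph_adj hS]; simp
    obtain ⟨w, hw⟩ := hS.isTree.connected.exists_walk_length_eq_dist (c * x) 1
    refine ⟨SimpleGraph.Walk.cons hadj w, ?_, by simp⟩
    apply SimpleGraph.Walk.isPath_of_length_eq_dist
    rw [SimpleGraph.Walk.length_cons, hw, hc]
  obtain ⟨w, hw, hwa⟩ := key a ha
  obtain ⟨w', hw', hwb⟩ := key b hb
  have : w = w' := (hS.isTree.existsUnique_path x 1).unique hw hw'
  subst this
  exact Subtype.ext (mul_right_cancel (hwa.symm.trans hwb))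

/-- Away from the identity some generator decreases the distance to the identity. -/
theorem exists_dist_eq_add_one (hS : IsTreeGenerating S) {x : Γ} (hx : x ≠ 1) :
    ∃ a : S, (cayleyGraph S).dist x 1 = (cayleyGraph S).dist (a * x) 1 + 1 := by
  obtain ⟨w, hw⟩ := hS.isTree.connected.exists_walk_length_eq_dist x 1
  cases w with
  | nil => exact absurd rfl hx
  | @cons _ y _ hadj w =>
    refine ⟨⟨y * x⁻¹, (cayleyGraph_adj hS x y).1 hadj⟩, ?_⟩
    have hle := SimpleGraph.dist_le w
    rw [SimpleGraph.Walk.length_cons] at hw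
    have := dist_mul_eq_or hS x ⟨y * x⁻¹, (cayleyGraph_adj hS x y).1 hadj⟩
    simp only [inv_mul_cancel_right] at this ⊢
    omega

open Classical in
/-- The generator leading from `x` one step towards the identity. At `x = 1`, where there is none,
it is an arbitrary element of `S`. -/
def backward [Nonempty S] (x : Γ) : S :=
  if h : ∃ a : S, (cayleyGraph S).dist x 1 = (cayleyGraph S).dist (a * x) 1 + 1 then h.choose
  else Classical.arbitrary S

theorem dist_backward_mul [Nonempty S] (hS : IsTreeGenerating S) {x : Γ} (hx : x ≠ 1) :
    (cayleyGraph S).dist x 1 = (cayleyGraph S).dist ((backward x : S) * x) 1 + 1 := by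
  have h := exists_dist_eq_add_one hS hx
  rw [backward, dif_pos h]
  exact h.choose_spec

theorem height_zero (s : ℕ → S) : height s 0 = 0 := by
  simp [height, position]

open Classical in
theorem height_succ_of_ne [Nonempty S] (hS : IsTreeGenerating S) (s : ℕ → S) {n : ℕ}
    (h : position s n ≠ 1) :
    (height s (n + 1) : ℝ) =
      height s n + 1 - 2 * (if s (n + 1) = backward (position s n) then 1 else 0) := by
  have hb := dist_backward_mul hS h
  simp only [height, position]
  split_ifs with hs
  · rw [hs, hb]
    push_cast
    ring
  · have h1 := dist_mul_eq_or hS (position s n) (s (n + 1))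
    have h2 : ¬ (cayleyGraph S).dist (position s n) 1 =
        (cayleyGraph S).dist (s (n + 1) * position s n) 1 + 1 := fun h2 =>
      hs (eq_of_dist_lt hS h2 hb)
    rw [h1.resolve_right h2]
    push_cast
    ring

theorem height_succ_of_eq (hS : IsTreeGenerating S) (s : ℕ → S) {n : ℕ} (h : position s n = 1) :
    height s n = 0 ∧ height s (n + 1) = 1 := by
  have h0 : height s n = 0 := by simp [height, h]
  have h1 := dist_mul_eq_or hS (position s n) (s (n + 1))
  refine ⟨h0, ?_⟩
  change (cayleyGraph S).dist (position s n) 1 = 0 at h0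
  change (cayleyGraph S).dist (s (n + 1) * position s n) 1 = 1
  omega

theorem dependsOn_position (n : ℕ) :
    DependsOn (fun s : ℕ → S => position s n) (Set.Icc 1 n) := by
  induction n with
  | zero => intro s t _; rfl
  | succ n ih =>
    intro s t h
    change (s (n + 1) : Γ) * position s n = t (n + 1) * position t n
    rw [h (n + 1) ⟨by omega, le_rfl⟩]
    congr 1
    exact ih fun i hi => h i ⟨hi.1, hi.2.trans (by omega)⟩

theorem dependsOn_height (n : ℕ) :
    DependsOn (fun s : ℕ → S => height s n) (Set.Icc 1 n) := fun s t h => by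
  have := dependsOn_position n h
  simp only at this
  simp only [height, this]

end Tree

/-! ### Deviation of the step counts and the transition probabilities -/

section Expectation

variable {Γ : Type*} {S : Finset Γ}

/-- The coefficient `α = (p d - 1) / (d - 1)`, with which the past step frequencies enter the law of
the next step. -/
def memoryCoeff (S : Finset Γ) (p : ℝ) : ℝ := (p * S.card - 1) / ((S.card : ℝ) - 1)

open Classical in
/-- The number of occurrences of `a` among the steps `1, …, n`, minus its mean `n / d`. -/
def countDev (n : ℕ) (s : ℕ → S) (a : S) : ℝ :=
  ∑ k ∈ Finset.Icc 1 n, ((if s k = a then 1 else 0) - 1 / (S.card : ℝ))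

/-- The conditional probability that step `n + 1` is `a`. For `n = 0` the quotient is `0 / 0 = 0`,
which gives the uniform law of the first step. -/
def stepProb (p : ℝ) (n : ℕ) (s : ℕ → S) (a : S) : ℝ :=
  1 / (S.card : ℝ) + memoryCoeff S p * (countDev n s a / n)

theorem countDev_zero (s : ℕ → S) (a : S) : countDev 0 s a = 0 := by simp [countDev]

open Classical in
theorem countDev_succ (n : ℕ) (s : ℕ → S) (a : S) :
    countDev (n + 1) s a =
      countDev n s a + ((if s (n + 1) = a then 1 else 0) - 1 / (S.card : ℝ)) := by
  rw [countDev, Finset.sum_Icc_succ_top (by omega)]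
  rfl

theorem dependsOn_countDev (n : ℕ) (a : S) :
    DependsOn (fun s : ℕ → S => countDev n s a) (Set.Icc 1 n) := fun s t h => by
  refine Finset.sum_congr rfl fun k hk => ?_
  rw [h k (by simpa using hk)]

theorem nextStepProb_eq_stepProb (hd : 3 ≤ S.card) (p : ℝ) {n : ℕ} (hn : 1 ≤ n) (s : ℕ → S)
    (a : S) : nextStepProb S p n s a = stepProb p n s a := by
  classical
  have hd' : (3 : ℝ) ≤ S.card := by exact_mod_cast hd
  have h0 : (S.card : ℝ) ≠ 0 := by positivity
  have h1 : (S.card : ℝ) - 1 ≠ 0 := by linarith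
  have hn' : (n : ℝ) ≠ 0 := by positivity
  have hr : ∀ b : S, recallProb S p b a = 1 / (S.card : ℝ) +
      memoryCoeff S p * ((if b = a then 1 else 0) - 1 / (S.card : ℝ)) := by
    intro b
    by_cases hb : a = b
    · simp only [recallProb, memoryCoeff, hb, if_true]
      field_simp
      ring
    · simp only [recallProb, memoryCoeff, hb, Ne.symm hb, if_false]
      field_simp
      ring
  simp only [nextStepProb, stepProb, countDev, hr]
  rw [← Finset.mul_sum, Finset.sum_add_distrib, ← Finset.mul_sum]
  simp only [Finset.sum_const, Nat.card_Icc, nsmul_eq_mul]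
  rw [show n + 1 - 1 = n by omega]
  field_simp

/-! ### Expectations of functions of finitely many steps -/

variable {Ω : Type*} {g : ℕ → Ω → S}

/-- The event that the first `n` steps are those of `s`. -/
def cylinder (g : ℕ → Ω → S) (n : ℕ) (s : ℕ → S) : Set Ω :=
  {ω | ∀ k, 1 ≤ k → k ≤ n → g k ω = s k}

/-- The infinite path whose steps `1, …, n` are given by `t`, and are arbitrary elsewhere. -/
def extendPath [Nonempty S] {n : ℕ} (t : Fin n → S) (k : ℕ) : S :=
  if h : k - 1 < n then t ⟨k - 1, h⟩ else Classical.arbitrary S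

theorem mem_cylinder_extendPath [Nonempty S] {n : ℕ} (t : Fin n → S) (ω : Ω) :
    ω ∈ cylinder g n (extendPath t) ↔ t = fun i : Fin n => g (i + 1) ω := by
  constructor
  · intro h
    funext i
    have := h (i + 1) (by omega) (by omega)
    rw [this, extendPath, dif_pos (by simp)]
    rfl
  · rintro rfl k hk hkn
    rw [extendPath, dif_pos (by omega)]
    simp only
    rw [Nat.sub_add_cancel hk]

theorem sum_indicator_cylinder [Nonempty S] {n : ℕ} {f : (ℕ → S) → ℝ}
    (hf : DependsOn f (Set.Icc 1 n)) (ω : Ω) :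
    ∑ t : Fin n → S, (cylinder g n (extendPath t)).indicator (fun _ => f (extendPath t)) ω =
      f (fun k => g k ω) := by
  rw [Finset.sum_eq_single (fun i : Fin n => g (i + 1) ω)]
  · have h := (mem_cylinder_extendPath (g := g) (fun i : Fin n => g (i + 1) ω) ω).2 rfl
    rw [Set.indicator_of_mem h]
    exact hf fun k hk => (h k hk.1 hk.2).symm
  · intro t _ ht
    exact Set.indicator_of_notMem (fun h => ht ((mem_cylinder_extendPath t ω).1 h)) _
  · simp

variable [MeasurableSpace Ω] {p : ℝ} {P : Measure Ω}

/-- The expectation of a function of the steps. -/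
def expect (P : Measure Ω) (g : ℕ → Ω → S) (f : (ℕ → S) → ℝ) : ℝ :=
  ∫ ω, f (fun k => g k ω) ∂P

theorem IsElephantWalk.measurableSet_cylinder (hg : IsElephantWalk S p P g) (n : ℕ) (s : ℕ → S) :
    MeasurableSet (cylinder g n s) := by
  have : cylinder g n s = ⋂ k ∈ Finset.Icc 1 n, {ω | g k ω = s k} := by
    ext ω
    simp [cylinder]
  rw [this]
  exact Finset.measurableSet_biInter _ fun k hk =>
    hg.measurable_step k (Finset.mem_Icc.1 hk).1 _

variable [IsProbabilityMeasure P]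

theorem IsElephantWalk.integrable [Nonempty S] (hg : IsElephantWalk S p P g) {n : ℕ}
    {f : (ℕ → S) → ℝ} (hf : DependsOn f (Set.Icc 1 n)) :
    Integrable (fun ω => f (fun k => g k ω)) P := by
  simp_rw [← sum_indicator_cylinder (g := g) hf]
  exact integrable_finsetSum _ fun t _ =>
    (integrable_const _).indicator (hg.measurableSet_cylinder n _)

theorem IsElephantWalk.measureReal_cylinder_inter (hd : 3 ≤ S.card) (hg : IsElephantWalk S p P g)
    (n : ℕ) (s : ℕ → S) (a : S) :
    P.real (cylinder g n s ∩ {ω | g (n + 1) ω = a}) =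
      P.real (cylinder g n s) * stepProb p n s a := by
  rcases Nat.eq_zero_or_pos n with rfl | hn
  · have : cylinder g 0 s = Set.univ := by
      ext ω
      simp only [cylinder, Set.mem_ofPred_eq, Set.mem_univ, iff_true]
      omega
    rw [this, Set.univ_inter, zero_add, hg.first_step, probReal_univ]
    simp [stepProb]
  · rw [← nextStepProb_eq_stepProb hd p hn]
    exact hg.next_step n hn s a

open Classical in
/-- The Markov property, for a predicted next step `b` that depends on the past. -/
theorem IsElephantWalk.expect_step [Nonempty S] (hd : 3 ≤ S.card) (hg : IsElephantWalk S p P g)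
    {n : ℕ} {f h : (ℕ → S) → ℝ} {b : (ℕ → S) → S} (hf : DependsOn f (Set.Icc 1 n))
    (hh : DependsOn h (Set.Icc 1 n)) (hb : DependsOn b (Set.Icc 1 n)) :
    expect P g (fun s => h s + f s * (if s (n + 1) = b s then 1 else 0)) =
      expect P g (fun s => h s + f s * stepProb p n s (b s)) := by
  have hq : DependsOn (fun s => f s * stepProb p n s (b s)) (Set.Icc 1 n) := fun s t hst => by
    have := dependsOn_countDev n (b t) hst
    simp only at this
    simp only [hf hst, hb hst, stepProb, this]
  have hI : DependsOn (fun s => f s * (if s (n + 1) = b s then 1 else 0))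
      (Set.Icc 1 (n + 1)) := fun s t hst => by
    have hst' : ∀ i ∈ Set.Icc 1 n, s i = t i := fun i hi => hst i ⟨hi.1, hi.2.trans (by omega)⟩
    simp only [hf hst', hb hst', hst (n + 1) ⟨by omega, le_rfl⟩]
  simp only [expect]
  rw [integral_add (hg.integrable hh) (hg.integrable hI),
    integral_add (hg.integrable hh) (hg.integrable hq)]
  congr 1
  have h1 : ∀ ω, f (fun k => g k ω) * (if g (n + 1) ω = b (fun k => g k ω) then 1 else 0) =
      ∑ t : Fin n → S, (cylinder g n (extendPath t) ∩
        {ω | g (n + 1) ω = b (extendPath t)}).indicator (fun _ => f (extendPath t)) ω := by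
    intro ω
    rw [← sum_indicator_cylinder (g := g) hf, Finset.sum_mul]
    refine Finset.sum_congr rfl fun t _ => ?_
    by_cases hω : ω ∈ cylinder g n (extendPath t)
    · have : b (fun k => g k ω) = b (extendPath t) := hb fun k hk => hω k hk.1 hk.2
      simp [Set.indicator, hω, this]
    · simp [Set.indicator, hω]
  simp_rw [h1, ← sum_indicator_cylinder (g := g) hq]
  have hm : ∀ t : Fin n → S, MeasurableSet (cylinder g n (extendPath t) ∩
        {ω | g (n + 1) ω = b (extendPath t)}) := fun t =>
    (hg.measurableSet_cylinder n _).inter (hg.measurable_step _ (by omega) _)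
  rw [integral_finsetSum _ fun t _ => (integrable_const _).indicator (hm t),
    integral_finsetSum _ fun t _ =>
      (integrable_const _).indicator (hg.measurableSet_cylinder n _)]
  refine Finset.sum_congr rfl fun t _ => ?_
  rw [integral_indicator_const _ (hm t),
    integral_indicator_const _ (hg.measurableSet_cylinder n _),
    hg.measureReal_cylinder_inter hd]
  simp only [smul_eq_mul]
  ring

theorem IsElephantWalk.expect_mono [Nonempty S] (hg : IsElephantWalk S p P g) {n k : ℕ}
    {f h : (ℕ → S) → ℝ}
    (hf : DependsOn f (Set.Icc 1 n)) (hh : DependsOn h (Set.Icc 1 k)) (hle : ∀ s, f s ≤ h s) :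
    expect P g f ≤ expect P g h :=
  integral_mono (hg.integrable hf) (hg.integrable hh) fun _ => hle _

theorem IsElephantWalk.expect_linear [Nonempty S] (hg : IsElephantWalk S p P g) {n k : ℕ}
    {f h : (ℕ → S) → ℝ}
    (hf : DependsOn f (Set.Icc 1 n)) (hh : DependsOn h (Set.Icc 1 k)) (x y z : ℝ) :
    expect P g (fun s => x * f s + y * h s + z) = x * expect P g f + y * expect P g h + z := by
  simp only [expect]
  have h1 := (hg.integrable hf).const_mul x
  have h2 := (hg.integrable hh).const_mul y
  have h12 : Integrable (fun ω => x * f (fun k => g k ω) + y * h (fun k => g k ω)) P := h1.add h2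
  rw [integral_add h12 (integrable_const z), integral_add h1 h2, integral_const_mul,
    integral_const_mul]
  simp

theorem IsElephantWalk.expect_sum [Nonempty S] (hg : IsElephantWalk S p P g) {n : ℕ}
    {f : S → (ℕ → S) → ℝ}
    (hf : ∀ a, DependsOn (f a) (Set.Icc 1 n)) :
    expect P g (fun s => ∑ a, f a s) = ∑ a, expect P g (f a) := by
  simp only [expect]
  exact integral_finsetSum _ fun a _ => hg.integrable (hf a)

end Expectation

/-! ### Second moments of the step counts and of the centred height -/

section Moments

variable {Γ : Type*} {S : Finset Γ} {Ω : Type*} [MeasurableSpace Ω] {p : ℝ} {P : Measure Ω}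
  [IsProbabilityMeasure P] {g : ℕ → Ω → S}

theorem one_div_card_mem (hd : 3 ≤ S.card) :
    0 < 1 / (S.card : ℝ) ∧ 1 / (S.card : ℝ) ≤ 1 / 3 := by
  have hd' : (3 : ℝ) ≤ S.card := by exact_mod_cast hd
  exact ⟨by positivity, one_div_le_one_div_of_le (by norm_num) hd'⟩

/-- The recursion for the second moments of the step counts. At `n = 0` the quotient is zero. -/
theorem IsElephantWalk.expect_sq_countDev_succ_le [Nonempty S] (hd : 3 ≤ S.card)
    (hg : IsElephantWalk S p P g) (n : ℕ) (a : S) :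
    expect P g (fun s => countDev (n + 1) s a ^ 2) ≤
      (1 + 2 * memoryCoeff S p / n) * expect P g (fun s => countDev n s a ^ 2) + 1 := by
  classical
  have hc := one_div_card_mem hd
  set c := 1 / (S.card : ℝ) with hcdef
  have hY := dependsOn_countDev n a
  have hY' := dependsOn_countDev (n + 1) a
  have hf : DependsOn (fun s => 2 * countDev n s a) (Set.Icc 1 n) := fun s t h => by
    have := hY h
    simp only at this ⊢
    rw [this]
  have hh : DependsOn (fun s => countDev n s a ^ 2 - 2 * c * countDev n s a + 1) (Set.Icc 1 n) :=
    fun s t h => by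
      have := hY h
      simp only at this ⊢
      rw [this]
  have hsq : DependsOn (fun s => countDev n s a ^ 2) (Set.Icc 1 n) := fun s t h => by
    have := hY h
    simp only at this ⊢
    rw [this]
  have hsq' : DependsOn (fun s => countDev (n + 1) s a ^ 2) (Set.Icc 1 (n + 1)) := fun s t h => by
    have := hY' h
    simp only at this ⊢
    rw [this]
  have hstep : DependsOn (fun s : ℕ → S => countDev n s a ^ 2 - 2 * c * countDev n s a + 1 +
      2 * countDev n s a * (if s (n + 1) = a then 1 else 0)) (Set.Icc 1 (n + 1)) := fun s t h => by
    have h1 := hY fun i hi => h i ⟨hi.1, hi.2.trans (by omega)⟩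
    simp only at h1 ⊢
    rw [h1, h (n + 1) ⟨by omega, le_rfl⟩]
  calc expect P g (fun s => countDev (n + 1) s a ^ 2)
      ≤ expect P g (fun s => countDev n s a ^ 2 - 2 * c * countDev n s a + 1 +
          2 * countDev n s a * (if s (n + 1) = a then 1 else 0)) := by
        refine hg.expect_mono hsq' hstep fun s => ?_
        rw [countDev_succ]
        split_ifs <;> nlinarith
    _ = expect P g (fun s => (1 + 2 * memoryCoeff S p / n) * countDev n s a ^ 2 +
          0 * countDev n s a ^ 2 + 1) := by
        rw [hg.expect_step hd hf hh (fun _ _ _ => rfl)]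
        congr 1
        funext s
        rw [stepProb, ← hcdef]
        ring
    _ = _ := by
        rw [hg.expect_linear hsq hsq]
        ring

theorem abs_countDev_le (hd : 3 ≤ S.card) (n : ℕ) (s : ℕ → S) (a : S) : |countDev n s a| ≤ n := by
  classical
  have hc := one_div_card_mem hd
  calc |countDev n s a| ≤ ∑ k ∈ Finset.Icc 1 n, (1 : ℝ) := by
        refine (Finset.abs_sum_le_sum_abs _ _).trans (Finset.sum_le_sum fun k _ => ?_)
        rw [abs_le]
        split_ifs <;> constructor <;> linarith
    _ = n := by simp

theorem stepProb_mem (hd : 3 ≤ S.card) (hα : |memoryCoeff S p| ≤ 1 / 2 * (1 / (S.card : ℝ)))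
    (n : ℕ) (s : ℕ → S) (a : S) :
    1 / 2 * (1 / (S.card : ℝ)) ≤ stepProb p n s a ∧ stepProb p n s a ≤ 1 / 2 := by
  have hc := one_div_card_mem hd
  have h : |memoryCoeff S p * (countDev n s a / n)| ≤ 1 / 2 * (1 / (S.card : ℝ)) := by
    rw [abs_mul, abs_div, Nat.abs_cast]
    have := div_le_one_of_le₀ (abs_countDev_le hd n s a) n.cast_nonneg
    exact (mul_le_of_le_one_right (abs_nonneg _) this).trans hα
  rw [abs_le] at h
  rw [stepProb]
  constructor <;> linarith [h.1, h.2]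

theorem sq_countDev_le_sum (n : ℕ) (s : ℕ → S) (b : S) :
    countDev n s b ^ 2 ≤ ∑ a, countDev n s a ^ 2 :=
  Finset.single_le_sum (f := fun a => countDev n s a ^ 2) (fun _ _ => sq_nonneg _)
    (Finset.mem_univ b)

theorem dependsOn_sum_sq_countDev (n : ℕ) :
    DependsOn (fun s : ℕ → S => ∑ a, countDev n s a ^ 2) (Set.Icc 1 n) := fun s t h => by
  refine Finset.sum_congr rfl fun a _ => ?_
  have := dependsOn_countDev n a h
  simp only at this
  rw [this]

theorem abs_memoryCoeff_le_one (hd : 3 ≤ S.card) (hp0 : 0 ≤ p) (hp1 : p < 1) :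
    |memoryCoeff S p| ≤ 1 := by
  have hd' : (3 : ℝ) ≤ S.card := by exact_mod_cast hd
  rw [memoryCoeff, abs_div, abs_of_pos (show (0 : ℝ) < S.card - 1 by linarith),
    div_le_one (by linarith), abs_le]
  constructor <;> nlinarith

variable [Group Γ]

/-- The height after `n` steps, minus its asymptotic mean `n (d - 2) / d`. -/
def heightDev (n : ℕ) (s : ℕ → S) : ℝ := height s n - (1 - 2 / (S.card : ℝ)) * n

theorem dependsOn_heightDev (n : ℕ) :
    DependsOn (fun s : ℕ → S => heightDev n s) (Set.Icc 1 n) := fun s t h => by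
  have := dependsOn_height n h
  simp only at this
  simp only [heightDev, this]

theorem dependsOn_backward_position [Nonempty S] (n : ℕ) :
    DependsOn (fun s : ℕ → S => (backward (position s n) : S)) (Set.Icc 1 n) := fun s t h => by
  have := dependsOn_position n h
  simp only at this
  simp only [this]

theorem dependsOn_countDev_backward [Nonempty S] (n : ℕ) :
    DependsOn (fun s : ℕ → S => countDev n s (backward (position s n))) (Set.Icc 1 n) :=
  fun s t h => by
    have := dependsOn_backward_position n h
    have h1 := dependsOn_countDev n (backward (position t n) : S) h
    simp only at this h1
    simp only [this, h1]

open Classical in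
/-- At the identity the walk moves away although the backward generator is arbitrary there; as the
centred height is nonpositive at such times, this only decreases the square. -/
theorem sq_heightDev_succ_le [Nonempty S] (hd : 3 ≤ S.card) (hS : IsTreeGenerating S) (n : ℕ)
    (s : ℕ → S) :
    heightDev (n + 1) s ^ 2 ≤ heightDev n s ^ 2 + 4 * (1 / (S.card : ℝ)) * heightDev n s + 4 +
      -4 * heightDev n s * (if s (n + 1) = backward (position s n) then 1 else 0) := by
  have hc := one_div_card_mem hd
  have h2 : (2 : ℝ) / S.card = 2 * (1 / (S.card : ℝ)) := by ring
  rw [heightDev, heightDev, h2]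
  set c := 1 / (S.card : ℝ)
  push_cast
  by_cases h : position s n = 1
  · obtain ⟨h0, h1⟩ := height_succ_of_eq hS s h
    rw [h0, h1]
    push_cast
    have hn : (0 : ℝ) ≤ n := n.cast_nonneg
    split_ifs <;> nlinarith [mul_nonneg hn hc.1.le]
  · rw [height_succ_of_ne hS s h]
    split_ifs <;> nlinarith

/-- The cross term `-4 α D Y / n` is split as `(D ^ 2 / 2 + 8 Y ^ 2) / n`; the weight `1 / 2` on `D ^ 2`
is below the growth exponent of the source term in each regime. -/
theorem IsElephantWalk.expect_sq_heightDev_succ_le [Nonempty S] (hd : 3 ≤ S.card)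
    (hS : IsTreeGenerating S) (hα : |memoryCoeff S p| ≤ 1) (hg : IsElephantWalk S p P g) (n : ℕ) :
    expect P g (fun s => heightDev (n + 1) s ^ 2) ≤
      (1 + 1 / 2 / (n : ℝ)) * expect P g (fun s => heightDev n s ^ 2) +
        8 / (n : ℝ) * ∑ a, expect P g (fun s => countDev n s a ^ 2) + 4 := by
  classical
  have hD := dependsOn_heightDev (S := S) n
  have hD' := dependsOn_heightDev (S := S) (n + 1)
  have hb := dependsOn_backward_position (S := S) n
  have hsq : ∀ k, DependsOn (fun s : ℕ → S => heightDev k s ^ 2) (Set.Icc 1 k) := fun k s t h => by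
    have := dependsOn_heightDev k h
    simp only at this
    simp only [this]
  have hf : DependsOn (fun s : ℕ → S => -4 * heightDev n s) (Set.Icc 1 n) := fun s t h => by
    have := hD h
    simp only at this
    simp only [this]
  have hh : DependsOn (fun s : ℕ → S => heightDev n s ^ 2 + 4 * (1 / (S.card : ℝ)) * heightDev n s
      + 4) (Set.Icc 1 n) := fun s t h => by
    have := hD h
    simp only at this
    simp only [this]
  have hstep : DependsOn (fun s : ℕ → S => heightDev n s ^ 2 +
      4 * (1 / (S.card : ℝ)) * heightDev n s + 4 +
      -4 * heightDev n s * (if s (n + 1) = backward (position s n) then 1 else 0))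
      (Set.Icc 1 (n + 1)) := fun s t h => by
    have hst : ∀ i ∈ Set.Icc 1 n, s i = t i := fun i hi => h i ⟨hi.1, hi.2.trans (by omega)⟩
    have h1 := hD hst
    have h2 := hb hst
    simp only at h1 h2
    simp only [h1, h2, h (n + 1) ⟨by omega, le_rfl⟩]
  have hq : DependsOn (fun s : ℕ → S => heightDev n s ^ 2 +
      4 * (1 / (S.card : ℝ)) * heightDev n s + 4 +
      -4 * heightDev n s * stepProb p n s (backward (position s n))) (Set.Icc 1 n) :=
    fun s t h => by
      have h1 := hD h
      have h2 := dependsOn_countDev_backward n h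
      simp only at h1 h2
      simp only [stepProb, h1, h2]
  have hW := dependsOn_sum_sq_countDev (S := S) n
  have hlin : DependsOn (fun s : ℕ → S => (1 + 1 / 2 / (n : ℝ)) * heightDev n s ^ 2 +
      8 / (n : ℝ) * ∑ a, countDev n s a ^ 2 + 4) (Set.Icc 1 n) := fun s t h => by
    have h1 := hD h
    have h2 := hW h
    simp only at h1 h2
    simp only [h1, h2]
  calc expect P g (fun s => heightDev (n + 1) s ^ 2)
      ≤ _ := hg.expect_mono (hsq _) hstep fun s => sq_heightDev_succ_le hd hS n s
    _ = _ := hg.expect_step hd hf hh hb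
    _ ≤ expect P g (fun s => (1 + 1 / 2 / (n : ℝ)) * heightDev n s ^ 2 +
          8 / (n : ℝ) * ∑ a, countDev n s a ^ 2 + 4) := by
        refine hg.expect_mono hq hlin fun s => ?_
        have hY := sq_countDev_le_sum n s (backward (position s n))
        set Y := countDev n s (backward (position s n))
        set D := heightDev n s
        set α := memoryCoeff S p
        have hα2 : α ^ 2 ≤ 1 := by
          rw [← sq_abs]
          exact pow_le_one₀ (abs_nonneg _) hα
        have key : -4 * D * α * Y ≤ 1 / 2 * D ^ 2 + 8 * ∑ a, countDev n s a ^ 2 := by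
          nlinarith [sq_nonneg (D + 4 * α * Y), sq_nonneg Y,
            mul_le_mul_of_nonneg_right hα2 (sq_nonneg Y)]
        have hn : (0 : ℝ) ≤ (n : ℝ)⁻¹ := by positivity
        have := mul_le_mul_of_nonneg_right key hn
        rw [stepProb]
        simp only [div_eq_mul_inv] at this ⊢
        linarith
    _ = _ := by
        rw [hg.expect_linear (hsq n) hW, hg.expect_sum]
        intro a s t h
        have := dependsOn_countDev n a h
        simp only at this
        simp only [this]

/-- A bound `A φ n` on the second moments of the step counts passes to the centred height, provided
that `φ n / n` is nondecreasing. -/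
theorem IsElephantWalk.expect_sq_heightDev_le [Nonempty S] (hd : 3 ≤ S.card)
    (hS : IsTreeGenerating S) (hα : |memoryCoeff S p| ≤ 1) (hg : IsElephantWalk S p P g)
    {φ : ℕ → ℝ} {A : ℝ} (hφ : ∀ n : ℕ, 1 ≤ n → (n : ℝ) ≤ φ n)
    (hφ' : ∀ n : ℕ, 1 ≤ n → (1 + 1 / (n : ℝ)) * φ n ≤ φ (n + 1)) (hA : 0 ≤ A)
    (hY : ∀ n, 1 ≤ n → ∀ a, expect P g (fun s => countDev n s a ^ 2) ≤ A * φ n) {n : ℕ}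
    (hn : 1 ≤ n) :
    expect P g (fun s => heightDev n s ^ 2) ≤ (16 * S.card * A + 8) * φ n := by
  have hdA : 0 ≤ S.card * A := by positivity
  induction n, hn using Nat.le_induction with
  | base =>
    have h := hg.expect_sq_heightDev_succ_le hd hS hα 0
    have h1 := hφ 1 le_rfl
    simp only [countDev_zero, heightDev, height_zero, expect] at h ⊢
    norm_num at h h1 ⊢
    nlinarith
  | succ n hn ih =>
    have hn' : (0 : ℝ) < n := by exact_mod_cast hn
    have hsum : ∑ a : S, expect P g (fun s => countDev n s a ^ 2) ≤ S.card * A * φ n := by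
      calc _ ≤ ∑ a : S, A * φ n := Finset.sum_le_sum fun a _ => hY n hn a
        _ = _ := by simp [mul_assoc]
    have h1 : 1 ≤ φ n * (n : ℝ)⁻¹ := by
      rw [← div_eq_mul_inv, le_div_iff₀ hn']
      linarith [hφ n hn]
    calc _ ≤ _ := hg.expect_sq_heightDev_succ_le hd hS hα n
      _ ≤ (1 + 1 / 2 / (n : ℝ)) * ((16 * S.card * A + 8) * φ n) +
          8 / (n : ℝ) * (S.card * A * φ n) + 4 * (φ n * (n : ℝ)⁻¹) := by
        gcongr
        linarith
      _ = (16 * S.card * A + 8) * ((1 + 1 / (n : ℝ)) * φ n) := by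
        field_simp
        ring
      _ ≤ _ := mul_le_mul_of_nonneg_left (hφ' n hn) (by linarith)

end Moments

/-! ### Growth rates in the three regimes -/

section Rates

theorem speedErrorMoment_eq {Γ : Type*} [Group Γ] {S : Finset Γ} {Ω : Type*} [MeasurableSpace Ω]
    {P : Measure Ω} {g : ℕ → Ω → S} (hd : 3 ≤ S.card) (m : ℝ) {n : ℕ} (hn : 1 ≤ n) :
    speedErrorMoment P g m n = expect P g (fun s => |heightDev n s / n| ^ m) := by
  have hd' : (3 : ℝ) ≤ S.card := by exact_mod_cast hd
  have h0 : (S.card : ℝ) ≠ 0 := by positivity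
  have hn' : (n : ℝ) ≠ 0 := by positivity
  have h : ∀ s : ℕ → S, heightDev n s / n = (height s n : ℝ) / n - (S.card - 2) / S.card := by
    intro s
    rw [heightDev]
    field_simp
  simp only [speedErrorMoment, expect, h]

variable {Γ : Type*} {S : Finset Γ} {Ω : Type*} [MeasurableSpace Ω] {p : ℝ} {P : Measure Ω}
  [IsProbabilityMeasure P] {g : ℕ → Ω → S}

theorem memoryCoeff_sub_half (hd : 3 ≤ S.card) :
    memoryCoeff S p - 1 / 2 = (p - criticalParam S.card) * (S.card / (S.card - 1)) := by
  have hd' : (3 : ℝ) ≤ S.card := by exact_mod_cast hd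
  have h0 : (S.card : ℝ) ≠ 0 := by positivity
  have h1 : (S.card : ℝ) - 1 ≠ 0 := by linarith
  rw [memoryCoeff, criticalParam]
  field_simp
  ring

theorem memoryCoeff_eq (hd : 3 ≤ S.card) :
    memoryCoeff S p = (p - 1 / (S.card : ℝ)) * (S.card / (S.card - 1)) := by
  have hd' : (3 : ℝ) ≤ S.card := by exact_mod_cast hd
  have h0 : (S.card : ℝ) ≠ 0 := by positivity
  have h1 : (S.card : ℝ) - 1 ≠ 0 := by linarith
  rw [memoryCoeff]
  field_simp

theorem card_div_pos (hd : 3 ≤ S.card) : 0 < (S.card : ℝ) / (S.card - 1) := by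
  have hd' : (3 : ℝ) ≤ S.card := by exact_mod_cast hd
  exact div_pos (by positivity) (by linarith)

theorem neg_half_le_memoryCoeff (hd : 3 ≤ S.card) (hp0 : 0 ≤ p) :
    -(1 / 2) ≤ memoryCoeff S p := by
  have hd' : (3 : ℝ) ≤ S.card := by exact_mod_cast hd
  rw [memoryCoeff, le_div_iff₀ (by linarith)]
  nlinarith

theorem one_add_two_mul_div_nonneg {α : ℝ} (hα : -(1 / 2) ≤ α) {n : ℕ} (hn : 1 ≤ n) :
    0 ≤ 1 + 2 * α / n := by
  have hn' : (1 : ℝ) ≤ n := by exact_mod_cast hn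
  rw [show 1 + 2 * α / n = (n + 2 * α) / n by field_simp]
  exact div_nonneg (by linarith) (by linarith)

theorem IsElephantWalk.expect_sq_countDev_one_le [Nonempty S] (hd : 3 ≤ S.card)
    (hg : IsElephantWalk S p P g) (a : S) :
    expect P g (fun s => countDev 1 s a ^ 2) ≤ 1 := by
  have h := hg.expect_sq_countDev_succ_le hd 0 a
  simp only [countDev_zero, expect] at h ⊢
  norm_num at h ⊢
  exact h

/-- A supersolution of the recursion for the second moments of the step counts bounds them. -/
theorem IsElephantWalk.expect_sq_countDev_le [Nonempty S] (hd : 3 ≤ S.card)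
    (hα : -(1 / 2) ≤ memoryCoeff S p) (hg : IsElephantWalk S p P g) {ψ : ℕ → ℝ} (h1 : 1 ≤ ψ 1)
    (hψ : ∀ n : ℕ, 1 ≤ n → (1 + 2 * memoryCoeff S p / n) * ψ n + 1 ≤ ψ (n + 1)) {n : ℕ}
    (hn : 1 ≤ n) (a : S) : expect P g (fun s => countDev n s a ^ 2) ≤ ψ n := by
  induction n, hn using Nat.le_induction with
  | base => exact (hg.expect_sq_countDev_one_le hd a).trans h1
  | succ n hn ih =>
    calc _ ≤ _ := hg.expect_sq_countDev_succ_le hd n a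
      _ ≤ (1 + 2 * memoryCoeff S p / n) * ψ n + 1 := by
        gcongr
        exact one_add_two_mul_div_nonneg hα hn
      _ ≤ _ := hψ n hn

theorem IsElephantWalk.expect_sq_countDev_le_subcritical [Nonempty S] (hd : 3 ≤ S.card)
    (hα : -(1 / 2) ≤ memoryCoeff S p) {A : ℝ} (hA : 1 ≤ A)
    (hA' : 1 ≤ A * (1 - 2 * memoryCoeff S p)) (hg : IsElephantWalk S p P g) {n : ℕ}
    (hn : 1 ≤ n) (a : S) : expect P g (fun s => countDev n s a ^ 2) ≤ A * n := by
  refine hg.expect_sq_countDev_le hd hα (ψ := fun n => A * n) (by simpa using hA)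
    (fun n hn => ?_) hn a
  have hn' : (n : ℝ) ≠ 0 := by positivity
  push_cast
  have : (1 + 2 * memoryCoeff S p / n) * (A * n) = A * n + 2 * memoryCoeff S p * A := by
    field_simp
  linarith

theorem one_le_mul_log_succ_sub_log {n : ℕ} (hn : 1 ≤ n) :
    1 ≤ ((n : ℝ) + 1) * (Real.log (n + 1) - Real.log n) := by
  have hn' : (0 : ℝ) < n := by exact_mod_cast hn
  rw [← Real.log_div (by positivity) (by positivity)]
  have := Real.one_sub_inv_le_log_of_pos (show (0 : ℝ) < (n + 1) / n by positivity)
  calc (1 : ℝ) = (n + 1) * (1 - ((n + 1) / n : ℝ)⁻¹) := by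
        field_simp
        ring
    _ ≤ _ := by gcongr

theorem IsElephantWalk.expect_sq_countDev_le_critical [Nonempty S] (hd : 3 ≤ S.card)
    (hα : memoryCoeff S p = 1 / 2) (hg : IsElephantWalk S p P g) {n : ℕ}
    (hn : 1 ≤ n) (a : S) :
    expect P g (fun s => countDev n s a ^ 2) ≤ n * (1 + Real.log n) := by
  refine hg.expect_sq_countDev_le hd (by rw [hα]; norm_num)
    (ψ := fun n => n * (1 + Real.log n)) (by simp) (fun n hn => ?_) hn a
  have hn' : (n : ℝ) ≠ 0 := by positivity
  have h := one_le_mul_log_succ_sub_log hn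
  rw [hα]
  push_cast
  have : (1 + 2 * (1 / 2) / (n : ℝ)) * (n * (1 + Real.log n)) =
      (n + 1) * (1 + Real.log n) := by
    field_simp
  linarith

theorem one_add_div_mul_rpow_le {β : ℝ} (hβ : 1 ≤ β) {n : ℕ} (hn : 1 ≤ n) :
    (1 + β / n) * (n : ℝ) ^ β ≤ ((n : ℝ) + 1) ^ β := by
  have hn' : (0 : ℝ) < n := by exact_mod_cast hn
  have h := one_add_mul_self_le_rpow_one_add (s := 1 / (n : ℝ))
    (by linarith [one_div_pos.2 hn']) hβ
  calc (1 + β / n) * (n : ℝ) ^ β = (1 + β * (1 / n)) * (n : ℝ) ^ β := by ring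
    _ ≤ (1 + 1 / n) ^ β * (n : ℝ) ^ β := by gcongr
    _ = ((n : ℝ) + 1) ^ β := by
      rw [← Real.mul_rpow (by positivity) (by positivity)]
      congr 1
      field_simp

theorem IsElephantWalk.expect_sq_countDev_le_supercritical [Nonempty S] (hd : 3 ≤ S.card)
    (hα : 1 / 2 < memoryCoeff S p) (hg : IsElephantWalk S p P g) {n : ℕ}
    (hn : 1 ≤ n) (a : S) :
    expect P g (fun s => countDev n s a ^ 2) ≤
      (1 / (2 * memoryCoeff S p - 1) + 1) * (n : ℝ) ^ (2 * memoryCoeff S p) := by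
  set α := memoryCoeff S p with hαdef
  set B := 1 / (2 * α - 1) with hB
  have hB0 : 0 < B := one_div_pos.2 (by linarith)
  have hB1 : B * (2 * α - 1) = 1 := by
    rw [hB]
    exact one_div_mul_cancel (by linarith)
  -- The linear correction `-B n` absorbs the source term of the recursion.
  have h := hg.expect_sq_countDev_le hd (by linarith)
    (ψ := fun n => (B + 1) * (n : ℝ) ^ (2 * α) - B * n) (by simp) (fun n hn => by
      have hn' : (n : ℝ) ≠ 0 := by positivity
      have h := mul_le_mul_of_nonneg_left (one_add_div_mul_rpow_le (β := 2 * α) (by linarith) hn)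
        (show 0 ≤ B + 1 by linarith)
      rw [← hαdef]
      push_cast
      have h2 : (1 + 2 * α / n) * (B * n) = B * n + 2 * α * B := by
        field_simp
      linarith) hn a
  have : 0 ≤ B * n := by positivity
  linarith

variable [Group Γ]

/-- The second moment of the speed error is at most a constant times `r_n ^ (-2)`, in each regime. -/
theorem exists_expect_sq_heightDev_le_rate (hd : 3 ≤ S.card) (hS : IsTreeGenerating S)
    (hp0 : 0 ≤ p) (hp1 : p < 1) :
    ∃ C : ℝ, 0 < C ∧ ∀ (Ω : Type v) [MeasurableSpace Ω] (P : Measure Ω) [IsProbabilityMeasure P]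
      (g : ℕ → Ω → S), IsElephantWalk S p P g →
      ∀ n : ℕ, 1 ≤ n → (p = criticalParam S.card → 2 ≤ n) →
        expect P g (fun s => heightDev n s ^ 2) / n ^ 2 ≤ C * rate S.card p n ^ (-2 : ℝ) := by
  have hne : Nonempty S := (Finset.card_pos.1 (by omega)).to_subtype
  have hα1 := abs_memoryCoeff_le_one (S := S) hd hp0 hp1
  have hα0 := neg_half_le_memoryCoeff (S := S) hd hp0
  have hα2 := memoryCoeff_sub_half (S := S) (p := p) hd
  have hc := card_div_pos (S := S) hd
  rcases lt_trichotomy p (criticalParam S.card) with hp | hp | hp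
  · have hα : memoryCoeff S p < 1 / 2 := by nlinarith
    have hα' : 0 < 1 - 2 * memoryCoeff S p := by linarith
    set A := 1 + 1 / (1 - 2 * memoryCoeff S p) with hAdef
    have hA : 1 ≤ A := by
      rw [hAdef]
      linarith [one_div_pos.2 hα']
    have hA' : 1 ≤ A * (1 - 2 * memoryCoeff S p) := by
      rw [hAdef, add_mul, one_div_mul_cancel hα'.ne']
      linarith
    refine ⟨16 * S.card * A + 8, by positivity, fun Ω _ P _ g hg n hn _ => ?_⟩
    have hn' : (0 : ℝ) < n := by exact_mod_cast hn
    have h := hg.expect_sq_heightDev_le hd hS hα1 (φ := fun n => (n : ℝ)) (fun n _ => le_rfl)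
      (fun n hn => by
        have : (n : ℝ) ≠ 0 := by positivity
        apply le_of_eq
        push_cast
        field_simp) (by linarith)
      (fun n hn a => hg.expect_sq_countDev_le_subcritical hd hα0 hA hA' hn a) hn
    rw [rate, if_pos hp, ← Real.rpow_mul hn'.le, div_le_iff₀ (by positivity), mul_assoc]
    refine h.trans_eq ?_
    rw [show (1 / 2 : ℝ) * -2 = -1 by norm_num, Real.rpow_neg_one]
    field_simp
  · have hα : memoryCoeff S p = 1 / 2 := by
      rw [hp, sub_self, zero_mul, ← hp] at hα2
      linarith
    refine ⟨(16 * S.card * 1 + 8) * 3, by positivity, fun Ω _ P _ g hg n hn hn2 => ?_⟩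
    have hn' : (0 : ℝ) < n := by exact_mod_cast hn
    have hn2' : (2 : ℝ) ≤ n := by exact_mod_cast hn2 hp
    have h := hg.expect_sq_heightDev_le hd hS hα1 (φ := fun n => (n : ℝ) * (1 + Real.log n))
      (fun n hn => by
        have h1 : (1 : ℝ) ≤ n := by exact_mod_cast hn
        nlinarith [Real.log_nonneg h1])
      (fun n hn => by
        have h1 : (1 : ℝ) ≤ n := by exact_mod_cast hn
        have h2 : (1 + 1 / (n : ℝ)) * (n * (1 + Real.log n)) = (n + 1) * (1 + Real.log n) := by
          field_simp
        rw [h2]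
        push_cast
        gcongr
        linarith) zero_le_one
      (fun n hn a => by
        rw [one_mul]
        exact hg.expect_sq_countDev_le_critical hd hα hn a) hn
    have hlog : 1 ≤ 2 * Real.log n := by
      have := Real.log_le_log (by norm_num) hn2'
      linarith [Real.log_two_gt_d9]
    have hr : rate S.card p n ^ (-2 : ℝ) = Real.log n / n := by
      rw [rate, if_neg hp.not_lt, if_pos hp, ← Real.rpow_mul (by positivity)]
      norm_num
      rw [Real.rpow_neg_one, inv_div]
    rw [hr, div_le_iff₀ (by positivity)]
    calc _ ≤ _ := h
      _ ≤ (16 * S.card * 1 + 8) * (n * (3 * Real.log n)) := by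
        gcongr
        linarith
      _ = _ := by
        field_simp
  · have hα : 1 / 2 < memoryCoeff S p := by nlinarith [mul_pos (sub_pos.2 hp) hc]
    set A := 1 / (2 * memoryCoeff S p - 1) + 1 with hAdef
    have hA : 0 ≤ A := by
      rw [hAdef]
      have := one_div_pos.2 (show 0 < 2 * memoryCoeff S p - 1 by linarith)
      linarith
    refine ⟨16 * S.card * A + 8, by positivity, fun Ω _ P _ g hg n hn _ => ?_⟩
    have hn' : (0 : ℝ) < n := by exact_mod_cast hn
    have h := hg.expect_sq_heightDev_le hd hS hα1
      (φ := fun n => (n : ℝ) ^ (2 * memoryCoeff S p)) (fun n hn => by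
        have h1 : (1 : ℝ) ≤ n := by exact_mod_cast hn
        exact Real.self_le_rpow_of_one_le h1 (by linarith))
      (fun n hn => by
        have h1 : (0 : ℝ) < n := by exact_mod_cast hn
        push_cast
        refine le_trans ?_ (one_add_div_mul_rpow_le (β := 2 * memoryCoeff S p) (by linarith) hn)
        gcongr
        linarith) hA
      (fun n hn a => hg.expect_sq_countDev_le_supercritical hd hα hn a) hn
    have hd' : (3 : ℝ) ≤ S.card := by exact_mod_cast hd
    have h0 : (S.card : ℝ) - 1 ≠ 0 := by linarith
    have he : (S.card : ℝ) * (1 - p) / (S.card - 1) * (-2) = 2 * memoryCoeff S p - 2 := by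
      rw [memoryCoeff]
      field_simp
      ring
    rw [rate, if_neg hp.not_gt, if_neg hp.ne', ← Real.rpow_mul hn'.le, he,
      Real.rpow_sub hn', div_le_iff₀ (by positivity)]
    refine h.trans_eq ?_
    norm_num
    field_simp

end Rates

/-! ### From second moments to moments of order between one and two -/

section Jensen

/-- The concave function `y ^ q` lies below an affine function whose value at `y = B` is `2 B ^ q`. -/
theorem rpow_le_affine {y B q : ℝ} (hy : 0 ≤ y) (hB : 0 < B) (hq0 : 0 ≤ q) (hq1 : q ≤ 1) :
    y ^ q ≤ B ^ q / B * y + B ^ q := by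
  have hBq : 0 < B ^ q := Real.rpow_pos_of_pos hB q
  have hz : (y / B) ^ q ≤ y / B + 1 := by
    rcases le_total (y / B) 1 with h | h
    · linarith [Real.rpow_le_one (div_nonneg hy hB.le) h hq0, div_nonneg hy hB.le]
    · linarith [Real.rpow_le_self_of_one_le h hq1]
  rw [Real.div_rpow hy hB.le, div_le_iff₀ hBq] at hz
  refine hz.trans_eq ?_
  ring

variable {Γ : Type*} {S : Finset Γ} {Ω : Type*} [MeasurableSpace Ω] {p : ℝ} {P : Measure Ω}
  [IsProbabilityMeasure P] {g : ℕ → Ω → S}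

theorem IsElephantWalk.expect_abs_rpow_le [Nonempty S] (hg : IsElephantWalk S p P g) {n : ℕ}
    {f : (ℕ → S) → ℝ} (hf : DependsOn f (Set.Icc 1 n)) {m B : ℝ} (hm0 : 0 ≤ m) (hm2 : m ≤ 2)
    (hB : 0 < B) (h : expect P g (fun s => f s ^ 2) ≤ B) :
    expect P g (fun s => |f s| ^ m) ≤ 2 * B ^ (m / 2) := by
  have h1 : DependsOn (fun s => |f s| ^ m) (Set.Icc 1 n) := fun s t hst => by simp only [hf hst]
  have h2 : DependsOn (fun s => f s ^ 2) (Set.Icc 1 n) := fun s t hst => by simp only [hf hst]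
  have h3 : DependsOn (fun s => B ^ (m / 2) / B * f s ^ 2 + 0 * f s ^ 2 + B ^ (m / 2))
    (Set.Icc 1 n) := fun s t hst => by simp only [hf hst]
  calc _ ≤ expect P g (fun s => B ^ (m / 2) / B * f s ^ 2 + 0 * f s ^ 2 + B ^ (m / 2)) := by
        refine hg.expect_mono h1 h3 fun s => ?_
        have := rpow_le_affine (sq_nonneg (f s)) hB (q := m / 2) (by linarith) (by linarith)
        rw [← sq_abs, ← Real.rpow_natCast, ← Real.rpow_mul (abs_nonneg _), Nat.cast_ofNat,
          mul_div_cancel₀ m two_ne_zero, Real.rpow_ofNat, sq_abs] at this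
        linarith
    _ = B ^ (m / 2) / B * expect P g (fun s => f s ^ 2) + B ^ (m / 2) := by
        rw [hg.expect_linear h2 h2]
        ring
    _ ≤ B ^ (m / 2) / B * B + B ^ (m / 2) := by gcongr
    _ = _ := by
        field_simp
        ring

theorem IsElephantWalk.rpow_le_expect_abs_rpow [Nonempty S] (hg : IsElephantWalk S p P g) {n : ℕ}
    {f : (ℕ → S) → ℝ} (hf : DependsOn f (Set.Icc 1 n)) {m t : ℝ} (hm : 1 ≤ m) (ht : 0 < t)
    (h : t ≤ expect P g (fun s => |f s|)) :
    t ^ m ≤ expect P g (fun s => |f s| ^ m) := by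
  have htm : 0 < t ^ m := Real.rpow_pos_of_pos ht m
  have h1 : DependsOn (fun s => |f s| ^ m) (Set.Icc 1 n) := fun s t hst => by simp only [hf hst]
  have h2 : DependsOn (fun s => |f s|) (Set.Icc 1 n) := fun s t hst => by simp only [hf hst]
  have h3 : DependsOn (fun s => t ^ m * m / t * |f s| + 0 * |f s| + t ^ m * (1 - m))
    (Set.Icc 1 n) := fun s t hst => by simp only [hf hst]
  calc t ^ m = t ^ m * m / t * t + t ^ m * (1 - m) := by
        field_simp
        ring
    _ ≤ t ^ m * m / t * expect P g (fun s => |f s|) + t ^ m * (1 - m) := by gcongr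
    _ = expect P g (fun s => t ^ m * m / t * |f s| + 0 * |f s| + t ^ m * (1 - m)) := by
        rw [hg.expect_linear h2 h2]
        ring
    _ ≤ _ := by
        refine hg.expect_mono h3 h1 fun s => ?_
        -- The tangent line of the convex function `x ^ m` at `t`.
        have hz : 0 ≤ |f s| / t := by positivity
        have := one_add_mul_self_le_rpow_one_add (s := |f s| / t - 1) (by linarith) hm
        rw [add_sub_cancel, Real.div_rpow (abs_nonneg _) ht.le, le_div_iff₀ htm] at this
        refine le_trans (le_of_eq ?_) this
        ring

end Jensen

/-! ### A martingale below the centred height -/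

section Lower

variable {Γ : Type*} [Group Γ] {S : Finset Γ} {Ω : Type*} [MeasurableSpace Ω] {p : ℝ}
  {P : Measure Ω} [IsProbabilityMeasure P] {g : ℕ → Ω → S}

open Classical in
/-- The compensated sum `∑ k < n, 2 (q_k - 1{g_{k+1} = b_k})`, where `b_k` is the backward generator at
`w_k` and `q_k` the conditional probability that step `k + 1` equals it. Under the law of the elephant
random walk it is a martingale. -/
def backwardMart [Nonempty S] (p : ℝ) : ℕ → (ℕ → S) → ℝ
  | 0, _ => 0
  | n + 1, s => backwardMart p n s + 2 * stepProb p n s (backward (position s n)) -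
      2 * (if s (n + 1) = backward (position s n) then 1 else 0)

/-- The sum over `k < n` of the absolute deviation from `1 / d` of the frequency, among the first `k`
steps, of the backward generator at `w_k`. The term `k = 0` is `0 / 0 = 0`. -/
def driftSum [Nonempty S] (n : ℕ) (s : ℕ → S) : ℝ :=
  ∑ k ∈ Finset.range n, |countDev k s (backward (position s k))| / k

theorem dependsOn_stepProb_backward [Nonempty S] (p : ℝ) (n : ℕ) :
    DependsOn (fun s : ℕ → S => stepProb p n s (backward (position s n))) (Set.Icc 1 n) :=
  fun s t h => by
    have := dependsOn_countDev_backward n h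
    simp only at this
    simp only [stepProb, this]

theorem dependsOn_backwardMart [Nonempty S] (p : ℝ) (n : ℕ) :
    DependsOn (fun s : ℕ → S => backwardMart p n s) (Set.Icc 1 n) := by
  induction n with
  | zero => intro s t _; rfl
  | succ n ih =>
    intro s t h
    have hst : ∀ i ∈ Set.Icc 1 n, s i = t i := fun i hi => h i ⟨hi.1, hi.2.trans (by omega)⟩
    have h1 := ih hst
    have h2 := dependsOn_stepProb_backward p n hst
    have h3 := dependsOn_backward_position n hst
    simp only at h1 h2 h3
    simp only [backwardMart]
    rw [h1, h2, h3, h (n + 1) ⟨by omega, le_rfl⟩]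

theorem dependsOn_driftSum [Nonempty S] (n : ℕ) :
    DependsOn (fun s : ℕ → S => driftSum n s) (Set.Icc 1 n) := fun s t h => by
  refine Finset.sum_congr rfl fun k hk => ?_
  have := dependsOn_countDev_backward k fun i hi =>
    h i ⟨hi.1, hi.2.trans (Finset.mem_range.1 hk).le⟩
  simp only at this
  simp only [this]

theorem driftSum_nonneg [Nonempty S] (n : ℕ) (s : ℕ → S) : 0 ≤ driftSum n s :=
  Finset.sum_nonneg fun _ _ => by positivity

/-- Visits to the identity only push the height up, so the walk dominates its martingale part minus
the accumulated drift error. -/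
theorem backwardMart_sub_le_heightDev [Nonempty S] (hS : IsTreeGenerating S) (p : ℝ) (n : ℕ)
    (s : ℕ → S) :
    backwardMart p n s - 2 * |memoryCoeff S p| * driftSum n s ≤ heightDev n s := by
  classical
  induction n with
  | zero => simp [backwardMart, driftSum, heightDev, height_zero]
  | succ n ih =>
    have h2 : (2 : ℝ) / S.card = 2 * (1 / (S.card : ℝ)) := by ring
    have hdrift : memoryCoeff S p * (countDev n s (backward (position s n)) / n) ≤
        |memoryCoeff S p| * (|countDev n s (backward (position s n))| / n) := by
      refine (le_abs_self _).trans_eq ?_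
      rw [abs_mul, abs_div, Nat.abs_cast]
    have hT : driftSum (n + 1) s =
        driftSum n s + |countDev n s (backward (position s n))| / n := by
      rw [driftSum, Finset.sum_range_succ]
      rfl
    rw [hT]
    simp only [backwardMart, stepProb]
    rw [heightDev, h2] at ih ⊢
    push_cast
    by_cases h : position s n = 1
    · obtain ⟨h0, h1⟩ := height_succ_of_eq hS s h
      rw [h0] at ih
      rw [h1]
      push_cast at ih ⊢
      split_ifs <;> linarith
    · rw [height_succ_of_ne hS s h]
      split_ifs <;> linarith

theorem IsElephantWalk.expect_backwardMart [Nonempty S] (hd : 3 ≤ S.card)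
    (hg : IsElephantWalk S p P g) (n : ℕ) : expect P g (fun s => backwardMart p n s) = 0 := by
  classical
  induction n with
  | zero => simp [expect, backwardMart]
  | succ n ih =>
    have h := hg.expect_step (n := n) hd (f := fun _ => -2)
      (h := fun s => backwardMart p n s + 2 * stepProb p n s (backward (position s n)))
      (b := fun s => backward (position s n)) (fun _ _ _ => rfl) (fun s t h => by
        have h1 := dependsOn_backwardMart p n h
        have h2 := dependsOn_stepProb_backward p n h
        simp only at h1 h2
        simp only [h1, h2]) (dependsOn_backward_position n)
    rw [← ih]
    simp only [backwardMart]
    convert h using 2 <;> funext s <;> ring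

theorem IsElephantWalk.expect_sq_backwardMart_succ [Nonempty S] (hd : 3 ≤ S.card)
    (hg : IsElephantWalk S p P g) (n : ℕ) :
    expect P g (fun s => backwardMart p (n + 1) s ^ 2) =
      expect P g (fun s => backwardMart p n s ^ 2 +
        4 * (stepProb p n s (backward (position s n)) *
          (1 - stepProb p n s (backward (position s n))))) := by
  classical
  have h := hg.expect_step (n := n) hd
    (f := fun s => 4 - 4 * (backwardMart p n s + 2 * stepProb p n s (backward (position s n))))
    (h := fun s => (backwardMart p n s + 2 * stepProb p n s (backward (position s n))) ^ 2)
    (b := fun s => backward (position s n)) (fun s t h => by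
        have h1 := dependsOn_backwardMart p n h
        have h2 := dependsOn_stepProb_backward p n h
        simp only at h1 h2
        simp only [h1, h2]) (fun s t h => by
        have h1 := dependsOn_backwardMart p n h
        have h2 := dependsOn_stepProb_backward p n h
        simp only at h1 h2
        simp only [h1, h2]) (dependsOn_backward_position n)
  simp only [backwardMart]
  convert h using 2
  · funext s
    split_ifs <;> ring
  · funext s
    ring

theorem IsElephantWalk.expect_sq_backwardMart_mem [Nonempty S] (hd : 3 ≤ S.card)
    (hα : |memoryCoeff S p| ≤ 1 / 2 * (1 / (S.card : ℝ))) (hg : IsElephantWalk S p P g) (n : ℕ) :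
    1 / (S.card : ℝ) * n ≤ expect P g (fun s => backwardMart p n s ^ 2) ∧
      expect P g (fun s => backwardMart p n s ^ 2) ≤ n := by
  have hM : ∀ (k : ℕ) (x : ℝ), DependsOn (fun s : ℕ → S => backwardMart p k s ^ 2 + x)
      (Set.Icc 1 k) := fun k x s t h => by
    have h1 := dependsOn_backwardMart p k h
    simp only at h1
    simp only [h1]
  have hM0 : ∀ k : ℕ, DependsOn (fun s : ℕ → S => backwardMart p k s ^ 2)
      (Set.Icc 1 k) := fun k s t h => by simpa using hM k 0 h
  have hadd : ∀ (k : ℕ) (x : ℝ), expect P g (fun s => backwardMart p k s ^ 2 + x) =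
      expect P g (fun s => backwardMart p k s ^ 2) + x := fun k x => by
    simpa using hg.expect_linear (hM0 k) (hM0 k) 1 0 x
  have hV : ∀ k, DependsOn (fun s : ℕ → S => backwardMart p k s ^ 2 +
        4 * (stepProb p k s (backward (position s k)) *
          (1 - stepProb p k s (backward (position s k))))) (Set.Icc 1 k) := fun k s t h => by
    have h1 := dependsOn_backwardMart p k h
    have h2 := dependsOn_stepProb_backward p k h
    simp only at h1 h2
    simp only [h1, h2]
  have hc := one_div_card_mem hd
  induction n with
  | zero => simp [expect, backwardMart]
  | succ n ih =>
    have hlow := hg.expect_mono (hM n (1 / (S.card : ℝ))) (hV n) fun s => by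
      have hq := stepProb_mem hd hα n s (backward (position s n))
      nlinarith
    have hup := hg.expect_mono (hV n) (hM n 1) fun s => by
      nlinarith [sq_nonneg (2 * stepProb p n s (backward (position s n)) - 1)]
    rw [← hg.expect_sq_backwardMart_succ hd, hadd] at hlow hup
    push_cast
    constructor <;> linarith [ih.1, ih.2]

theorem add_pow_four_le (x : ℝ) {z : ℝ} (hz : |z| ≤ 2) :
    (x + z) ^ 4 ≤ x ^ 4 + 4 * x ^ 3 * z + 40 * x ^ 2 + 32 := by
  have h2 : z ^ 2 ≤ 4 := by
    rw [← sq_abs]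
    nlinarith [abs_nonneg z]
  have h4 : z ^ 4 ≤ 16 := by nlinarith [sq_nonneg z]
  have h3 : 4 * x * z ^ 3 ≤ 16 * x ^ 2 + 16 := by
    nlinarith [mul_nonneg (sq_nonneg z) (sq_nonneg (2 * x - z)),
      mul_le_mul_of_nonneg_right h2 (sq_nonneg x)]
  nlinarith [mul_le_mul_of_nonneg_right h2 (sq_nonneg x)]

theorem IsElephantWalk.expect_pow_four_backwardMart_le [Nonempty S] (hd : 3 ≤ S.card)
    (hα : |memoryCoeff S p| ≤ 1 / 2 * (1 / (S.card : ℝ))) (hg : IsElephantWalk S p P g) (n : ℕ) :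
    expect P g (fun s => backwardMart p n s ^ 4) ≤ 32 * (n : ℝ) ^ 2 := by
  classical
  have hM : ∀ k, DependsOn (fun s : ℕ → S => backwardMart p k s ^ 4) (Set.Icc 1 k) :=
    fun k s t h => by
      have h1 := dependsOn_backwardMart p k h
      simp only at h1
      simp only [h1]
  have hM2 : ∀ k, DependsOn (fun s : ℕ → S => backwardMart p k s ^ 2) (Set.Icc 1 k) :=
    fun k s t h => by
      have h1 := dependsOn_backwardMart p k h
      simp only at h1
      simp only [h1]
  have hc := one_div_card_mem hd
  induction n with
  | zero => simp [expect, backwardMart]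
  | succ n ih =>
    have hf : DependsOn (fun s : ℕ → S => -8 * backwardMart p n s ^ 3) (Set.Icc 1 n) :=
      fun s t h => by
        have h1 := dependsOn_backwardMart p n h
        simp only at h1
        simp only [h1]
    have hh : DependsOn (fun s : ℕ → S => backwardMart p n s ^ 4 + 8 * backwardMart p n s ^ 3 *
        stepProb p n s (backward (position s n)) + 40 * backwardMart p n s ^ 2 + 32)
        (Set.Icc 1 n) := fun s t h => by
      have h1 := dependsOn_backwardMart p n h
      have h2 := dependsOn_stepProb_backward p n h
      simp only at h1 h2
      simp only [h1, h2]
    have hb := dependsOn_backward_position (S := S) n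
    have hstep : DependsOn (fun s : ℕ → S => backwardMart p n s ^ 4 + 8 * backwardMart p n s ^ 3 *
        stepProb p n s (backward (position s n)) + 40 * backwardMart p n s ^ 2 + 32 +
        -8 * backwardMart p n s ^ 3 * (if s (n + 1) = backward (position s n) then 1 else 0))
        (Set.Icc 1 (n + 1)) := fun s t h => by
      have hst : ∀ i ∈ Set.Icc 1 n, s i = t i := fun i hi => h i ⟨hi.1, hi.2.trans (by omega)⟩
      have h1 := hh hst
      have h2 := hf hst
      have h3 := hb hst
      simp only at h1 h2 h3
      simp only
      rw [h1, h2, h3, h (n + 1) ⟨by omega, le_rfl⟩]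
    calc expect P g (fun s => backwardMart p (n + 1) s ^ 4)
        ≤ _ := hg.expect_mono (hM _) hstep fun s => by
          have hq := stepProb_mem hd hα n s (backward (position s n))
          have hz := add_pow_four_le (backwardMart p n s)
            (z := 2 * stepProb p n s (backward (position s n)) -
              2 * (if s (n + 1) = backward (position s n) then 1 else 0)) (by
                rw [abs_le]
                split_ifs <;> constructor <;> linarith)
          simp only [backwardMart]
          rw [add_sub_assoc]
          linarith
      _ = _ := hg.expect_step hd hf hh hb
      _ = expect P g (fun s => 1 * backwardMart p n s ^ 4 + 40 * backwardMart p n s ^ 2 + 32) := by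
        congr 1
        funext s
        ring
      _ ≤ 32 * ((n + 1 : ℕ) : ℝ) ^ 2 := by
        rw [hg.expect_linear (hM n) (hM2 n)]
        push_cast
        nlinarith [(hg.expect_sq_backwardMart_mem hd hα n).2, n.cast_nonneg (α := ℝ)]

/-- The first moment of the martingale has order `√n`: its second moment is of order `n`, its fourth
moment of order `n ^ 2`, and `y ^ 2 - y ^ 4 ≤ |y|`. -/
theorem IsElephantWalk.le_expect_abs_backwardMart [Nonempty S] (hd : 3 ≤ S.card)
    (hα : |memoryCoeff S p| ≤ 1 / 2 * (1 / (S.card : ℝ))) (hg : IsElephantWalk S p P g) {n : ℕ}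
    (hn : 1 ≤ n) :
    √n / (10 * (S.card : ℝ) ^ 2) ≤ expect P g (fun s => |backwardMart p n s|) := by
  have hd' : (3 : ℝ) ≤ S.card := by exact_mod_cast hd
  have hd0 : (0 : ℝ) < S.card := by linarith
  have hn' : (0 : ℝ) < √n := Real.sqrt_pos.2 (by exact_mod_cast hn)
  have hsq : √(n : ℝ) ^ 2 = n := Real.sq_sqrt n.cast_nonneg
  have hM : ∀ F : ℝ → ℝ, DependsOn (fun s : ℕ → S => F (backwardMart p n s)) (Set.Icc 1 n) :=
    fun F s t h => by
      have h1 := dependsOn_backwardMart p n h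
      simp only at h1
      simp only [h1]
  -- The scale `r = 8 d √n` balances the second against the fourth moment.
  set r := 8 * S.card * √n with hr
  have hr0 : 0 < r := by positivity
  have h2 := (hg.expect_sq_backwardMart_mem hd hα n).1
  have h4 := hg.expect_pow_four_backwardMart_le hd hα n
  calc √n / (10 * (S.card : ℝ) ^ 2)
      ≤ r⁻¹ * (1 / S.card * n) + -(r⁻¹ ^ 3) * (32 * (n : ℝ) ^ 2) + 0 := by
        have : r⁻¹ * (1 / S.card * n) + -(r⁻¹ ^ 3) * (32 * (n : ℝ) ^ 2) + 0 =
            √n * (2 * S.card - 1) / (16 * S.card ^ 3) := by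
          rw [hr]
          generalize √(n : ℝ) = x at hsq hn'
          rw [← hsq]
          field_simp
          ring
        rw [this, div_le_div_iff₀ (by positivity) (by positivity)]
        have : 0 ≤ √(n : ℝ) * S.card ^ 2 * (4 * S.card - 10) := by
          have : 0 ≤ 4 * (S.card : ℝ) - 10 := by linarith
          positivity
        linarith
    _ ≤ r⁻¹ * expect P g (fun s => backwardMart p n s ^ 2) +
        -(r⁻¹ ^ 3) * expect P g (fun s => backwardMart p n s ^ 4) + 0 := by
        have := mul_le_mul_of_nonneg_left h2 (inv_nonneg.2 hr0.le)
        have := mul_le_mul_of_nonneg_left h4 (pow_nonneg (inv_nonneg.2 hr0.le) 3)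
        linarith
    _ = _ := (hg.expect_linear (hM fun x => x ^ 2) (hM fun x => x ^ 4) _ _ _).symm
    _ ≤ _ := hg.expect_mono (hM fun x => r⁻¹ * x ^ 2 + -(r⁻¹ ^ 3) * x ^ 4 + 0) (hM fun x => |x|)
      fun s => by
        have hy : ∀ y : ℝ, y ^ 2 - y ^ 4 ≤ |y| := fun y => by
          rw [← sq_abs y, ← Even.pow_abs (by decide : Even 4) y]
          have h0 := abs_nonneg y
          set z := |y|
          rcases le_total z 1 with h | h
          · nlinarith [pow_nonneg h0 4]
          · nlinarith [mul_nonneg (sq_nonneg z) (show 0 ≤ z ^ 2 - 1 by nlinarith)]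
        have := mul_le_mul_of_nonneg_left (hy (backwardMart p n s / r)) hr0.le
        rw [abs_div, abs_of_pos hr0, mul_div_cancel₀ _ hr0.ne'] at this
        refine le_trans (le_of_eq ?_) this
        field_simp
        ring

/-- By the inequality `|y| ≤ (1 + y ^ 2) / 2`, applied to `y = Y / √n`, the term at time `n` has mean of
order `1 / √n`. -/
theorem IsElephantWalk.expect_driftSum_le [Nonempty S] (hd : 3 ≤ S.card)
    (hα : |memoryCoeff S p| ≤ 1 / 4) (hg : IsElephantWalk S p P g) (n : ℕ) :
    expect P g (fun s => driftSum n s) ≤ 2 * (1 + 2 * S.card) * √n := by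
  have hα' := abs_le.1 hα
  have hT : ∀ n, DependsOn (fun s : ℕ → S => driftSum n s) (Set.Icc 1 n) := dependsOn_driftSum
  have hW := dependsOn_sum_sq_countDev (S := S)
  induction n with
  | zero => simp [expect, driftSum]
  | succ n ih =>
    rcases Nat.eq_zero_or_pos n with rfl | hn
    · simp only [expect, driftSum]
      simp
      positivity
    have hn' : (0 : ℝ) < n := by exact_mod_cast hn
    have hn1 : (1 : ℝ) ≤ n := by exact_mod_cast hn
    have ha : 0 < √(n : ℝ) := Real.sqrt_pos.2 hn'
    have hsq : √(n : ℝ) ^ 2 = n := Real.sq_sqrt hn'.le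
    have hsq1 : √((n : ℝ) + 1) ^ 2 = n + 1 := Real.sq_sqrt (by linarith)
    have hsum : ∑ a : S, expect P g (fun s => countDev n s a ^ 2) ≤ 2 * S.card * n := by
      calc _ ≤ ∑ a : S, 2 * (n : ℝ) := Finset.sum_le_sum fun a _ =>
            hg.expect_sq_countDev_le_subcritical hd (by linarith) (by norm_num) (by linarith) hn a
        _ = _ := by simp; ring
    have hdep : DependsOn (fun s : ℕ → S => 1 * driftSum n s +
        1 / (2 * √n * n) * (∑ a, countDev n s a ^ 2) + 1 / (2 * √n)) (Set.Icc 1 n) :=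
      fun s t h => by
        have h1 := hT n h
        have h2 := hW n h
        simp only at h1 h2
        simp only [h1, h2]
    calc _ ≤ expect P g (fun s => 1 * driftSum n s +
          1 / (2 * √n * n) * (∑ a, countDev n s a ^ 2) + 1 / (2 * √n)) := by
          refine hg.expect_mono (hT _) hdep fun s => ?_
          have hY := sq_countDev_le_sum n s (backward (position s n))
          rw [driftSum, Finset.sum_range_succ]
          change driftSum n s + _ ≤ _
          set Y := countDev n s (backward (position s n))
          have h1 : |Y| / n ≤ 1 / (2 * √n * n) * Y ^ 2 + 1 / (2 * √n) := by
            have : 1 / (2 * √(n : ℝ) * n) * Y ^ 2 + 1 / (2 * √n) - |Y| / n =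
                (|Y| - √n) ^ 2 / (2 * √n * n) := by
              rw [← sq_abs Y]
              generalize √(n : ℝ) = x at hsq ha
              rw [← hsq]
              field_simp
              ring
            have h0 : 0 ≤ (|Y| - √n) ^ 2 / (2 * √(n : ℝ) * n) := by positivity
            linarith
          have h2 := mul_le_mul_of_nonneg_left hY
            (show 0 ≤ 1 / (2 * √(n : ℝ) * n) by positivity)
          linarith
      _ = expect P g (fun s => driftSum n s) +
          1 / (2 * √n * n) * ∑ a, expect P g (fun s => countDev n s a ^ 2) + 1 / (2 * √n) := by
          rw [hg.expect_linear (hT n) (hW n), hg.expect_sum (n := n), one_mul]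
          intro a s t h
          have := dependsOn_countDev n a h
          simp only at this
          simp only [this]
      _ ≤ 2 * (1 + 2 * S.card) * √n + 1 / (2 * √n * n) * (2 * S.card * n) + 1 / (2 * √n) := by
          gcongr
      _ = (1 + 2 * S.card) * (2 * √n + 1 / (2 * √n)) := by
          field_simp
          ring
      _ ≤ (1 + 2 * S.card) * (2 * √((n + 1 : ℕ) : ℝ)) := by
          gcongr
          push_cast
          have hb : √(n : ℝ) ≤ √((n : ℝ) + 1) := Real.sqrt_le_sqrt (by linarith)
          set x := √(n : ℝ)
          set y := √((n : ℝ) + 1)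
          have hx1 : 1 ≤ x := by nlinarith
          have hyx : y ≤ 3 * x := by nlinarith
          rw [← le_sub_iff_add_le', div_le_iff₀ (by positivity)]
          nlinarith [mul_nonneg (sub_nonneg.2 hb) (sub_nonneg.2 hyx)]
      _ = _ := by ring

/-- Near `p = 1 / d` the drift error is too small to cancel the fluctuations of the martingale. -/
theorem IsElephantWalk.le_expect_abs_heightDev [Nonempty S] (hd : 3 ≤ S.card)
    (hS : IsTreeGenerating S) (hα : |memoryCoeff S p| ≤ 1 / (480 * (S.card : ℝ) ^ 3))
    (hg : IsElephantWalk S p P g) {n : ℕ} (hn : 1 ≤ n) :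
    √n / (40 * (S.card : ℝ) ^ 2) ≤ expect P g (fun s => |heightDev n s|) := by
  have hd' : (3 : ℝ) ≤ S.card := by exact_mod_cast hd
  have hd0 : (0 : ℝ) < S.card := by linarith
  have hα1 : |memoryCoeff S p| ≤ 1 / 2 * (1 / (S.card : ℝ)) := by
    refine hα.trans ?_
    rw [one_div_mul_one_div]
    refine one_div_le_one_div_of_le (by positivity) ?_
    linarith [le_self_pow₀ (show 1 ≤ (S.card : ℝ) by linarith) (show 3 ≠ 0 by norm_num)]
  have hα2 : |memoryCoeff S p| ≤ 1 / 4 := by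
    have := one_div_card_mem hd
    linarith
  have hM := hg.le_expect_abs_backwardMart hd hα1 hn
  have hM0 := hg.expect_backwardMart hd n
  have hT := hg.expect_driftSum_le hd hα2 n
  have dM := dependsOn_backwardMart (S := S) p n
  have dT := dependsOn_driftSum (S := S) n
  have dA : DependsOn (fun s : ℕ → S => |backwardMart p n s|) (Set.Icc 1 n) := fun s t h => by
    have h1 := dM h
    simp only at h1
    simp only [h1]
  have dX : DependsOn (fun s : ℕ → S => 1 / 2 * |backwardMart p n s| +
      1 / 2 * backwardMart p n s + 0) (Set.Icc 1 n) := fun s t h => by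
    have h1 := dM h
    simp only at h1
    simp only [h1]
  have dZ : DependsOn (fun s : ℕ → S => 1 * (1 / 2 * |backwardMart p n s| +
      1 / 2 * backwardMart p n s + 0) + -(2 * |memoryCoeff S p|) * driftSum n s + 0)
      (Set.Icc 1 n) := fun s t h => by
    have h1 := dM h
    have h2 := dT h
    simp only at h1 h2
    simp only [h1, h2]
  have dD : DependsOn (fun s : ℕ → S => |heightDev n s|) (Set.Icc 1 n) := fun s t h => by
    have h1 := dependsOn_heightDev n h
    simp only at h1
    simp only [h1]
  have hα3 : 2 * |memoryCoeff S p| * (2 * (1 + 2 * S.card) * √n) ≤ √n / (40 * (S.card : ℝ) ^ 2) := by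
    calc _ ≤ 2 * (1 / (480 * (S.card : ℝ) ^ 3)) * (2 * (3 * S.card) * √n) := by
          gcongr
          linarith
      _ = √n / (40 * (S.card : ℝ) ^ 2) := by
          field_simp
          norm_num
  have hstep := hg.expect_mono dZ dD fun s => by
    -- The positive part of the martingale is `(|M| + M) / 2`.
    have h1 := backwardMart_sub_le_heightDev hS p n s
    have h2 : 0 ≤ 2 * |memoryCoeff S p| * driftSum n s :=
      mul_nonneg (by positivity) (driftSum_nonneg n s)
    rcases abs_cases (backwardMart p n s) with h | h <;>
    rcases abs_cases (heightDev n s) with h' | h' <;> linarith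
  rw [hg.expect_linear dX dT, hg.expect_linear dA dM, hM0] at hstep
  have := mul_le_mul_of_nonneg_left hT (show 0 ≤ 2 * |memoryCoeff S p| by positivity)
  have e1 : √n / (10 * (S.card : ℝ) ^ 2) = 4 * (√n / (40 * (S.card : ℝ) ^ 2)) := by
    field_simp
    norm_num
  linarith

end Lower

/-! ### Upper and lower bounds for the speed error -/

section Bounds

theorem rate_pos {d : ℕ} {p : ℝ} {n : ℕ} (hn : 1 ≤ n) (hn2 : p = criticalParam d → 2 ≤ n) :
    0 < rate d p n := by
  have hn' : (0 : ℝ) < n := by exact_mod_cast hn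
  rw [rate]
  split_ifs with h1 h2
  · positivity
  · have : 0 < Real.log n := Real.log_pos (by exact_mod_cast hn2 h2)
    positivity
  · positivity

variable {Γ : Type*} [Group Γ] {S : Finset Γ} {p : ℝ}

/-- The upper bound for all orders up to two, the second moment included: no logarithmic factor
beyond the one in the critical rate is needed. -/
theorem exists_speedErrorMoment_le (hd : 3 ≤ S.card) (hS : IsTreeGenerating S)
    (hp0 : 0 ≤ p) (hp1 : p < 1) {m : ℝ} (hm0 : 0 ≤ m) (hm2 : m ≤ 2) :
    ∃ C : ℝ, 0 < C ∧ ∀ (Ω : Type v) [MeasurableSpace Ω] (P : Measure Ω) [IsProbabilityMeasure P]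
      (g : ℕ → Ω → S), IsElephantWalk S p P g →
      ∀ n : ℕ, 1 ≤ n → (p = criticalParam S.card → 2 ≤ n) →
        speedErrorMoment P g m n ≤ C * rate S.card p n ^ (-m) := by
  have hne : Nonempty S := (Finset.card_pos.1 (by omega)).to_subtype
  obtain ⟨C, hC, h⟩ := exists_expect_sq_heightDev_le_rate.{v} (p := p) hd hS hp0 hp1
  refine ⟨2 * C ^ (m / 2), by positivity, fun Ω _ P _ g hg n hn hn2 => ?_⟩
  have hr := rate_pos hn hn2
  have hD : DependsOn (fun s : ℕ → S => heightDev n s / n) (Set.Icc 1 n) := fun s t h => by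
    have h1 := dependsOn_heightDev n h
    simp only at h1
    simp only [h1]
  have hsq : expect P g (fun s => (heightDev n s / n) ^ 2) ≤
      C * rate S.card p n ^ (-2 : ℝ) := by
    refine le_trans (le_of_eq ?_) (h Ω P g hg n hn hn2)
    simp only [expect, div_pow]
    exact integral_div _ _
  rw [speedErrorMoment_eq hd m hn]
  refine (hg.expect_abs_rpow_le hD hm0 hm2 (by positivity) hsq).trans_eq ?_
  rw [Real.mul_rpow hC.le (by positivity), ← Real.rpow_mul hr.le, ← mul_assoc]
  congr 2
  ring

theorem IsElephantWalk.le_speedErrorMoment (hd : 3 ≤ S.card) (hS : IsTreeGenerating S)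
    (hp : |p - 1 / (S.card : ℝ)| ≤ 1 / (960 * (S.card : ℝ) ^ 3)) {m : ℝ} (hm : 1 ≤ m)
    {Ω : Type*} [MeasurableSpace Ω] {P : Measure Ω} [IsProbabilityMeasure P] {g : ℕ → Ω → S}
    (hg : IsElephantWalk S p P g) {n : ℕ} (hn : 1 ≤ n) :
    (1 / (40 * (S.card : ℝ) ^ 2)) ^ m * (n : ℝ) ^ (-m / 2) ≤ speedErrorMoment P g m n := by
  have hne : Nonempty S := (Finset.card_pos.1 (by omega)).to_subtype
  have hd' : (3 : ℝ) ≤ S.card := by exact_mod_cast hd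
  have hd0 : (0 : ℝ) < S.card := by linarith
  have hn' : (0 : ℝ) < n := by exact_mod_cast hn
  have hα : |memoryCoeff S p| ≤ 1 / (480 * (S.card : ℝ) ^ 3) := by
    have h2 : (S.card : ℝ) / (S.card - 1) ≤ 2 := by
      rw [div_le_iff₀ (by linarith)]
      linarith
    rw [memoryCoeff_eq hd, abs_mul, abs_of_pos (card_div_pos hd)]
    calc _ ≤ 1 / (960 * (S.card : ℝ) ^ 3) * 2 := by
          gcongr
          exact (card_div_pos hd).le
      _ = _ := by
          field_simp
          norm_num
  have h := hg.le_expect_abs_heightDev hd hS hα hn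
  have hD : DependsOn (fun s : ℕ → S => heightDev n s / n) (Set.Icc 1 n) := fun s t h => by
    have h1 := dependsOn_heightDev n h
    simp only at h1
    simp only [h1]
  have h1 : 1 / (40 * (S.card : ℝ) ^ 2) * (n : ℝ) ^ (-(1 / 2) : ℝ) ≤
      expect P g (fun s => |heightDev n s / n|) := by
    have he : expect P g (fun s => |heightDev n s / n|) =
        expect P g (fun s => |heightDev n s|) / n := by
      simp only [expect, abs_div, Nat.abs_cast]
      exact integral_div _ _
    rw [he, le_div_iff₀ hn', Real.rpow_neg hn'.le, ← Real.sqrt_eq_rpow]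
    refine le_trans (le_of_eq ?_) h
    have hs : 0 < √(n : ℝ) := Real.sqrt_pos.2 hn'
    have hsq : √(n : ℝ) ^ 2 = n := Real.sq_sqrt hn'.le
    generalize √(n : ℝ) = x at hs hsq
    rw [← hsq]
    field_simp
  have h2 := hg.rpow_le_expect_abs_rpow hD hm (by positivity) h1
  rw [speedErrorMoment_eq hd m hn]
  refine le_trans (le_of_eq ?_) h2
  rw [Real.mul_rpow (by positivity) (by positivity), ← Real.rpow_mul hn'.le]
  congr 2
  ring

end Bounds

end

end ElephantWalk

theorem theorem2 {Γ : Type u} [Group Γ] (S : Finset Γ) (hS : IsTreeGenerating S)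
    (d : ℕ) (hd : 3 ≤ d) (hcard : S.card = d) :
    -- upper bounds, for every memory parameter
    (∀ p : ℝ, 0 ≤ p → p < 1 →
      -- moments of order `1 ≤ m < 2`
      (∀ m : ℝ, 1 ≤ m → m < 2 → ∃ C : ℝ, 0 < C ∧
        ∀ (Ω : Type v) [MeasurableSpace Ω] (P : Measure Ω) [IsProbabilityMeasure P]
          (g : ℕ → Ω → S), IsElephantWalk S p P g →
          ∀ n : ℕ, 1 ≤ n → (p = criticalParam d → 2 ≤ n) →
            speedErrorMoment P g m n ≤ C * rate d p n ^ (-m)) ∧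
      -- second moment, subcritical and critical regimes
      (p ≤ criticalParam d → ∃ C : ℝ, 0 < C ∧
        ∀ (Ω : Type v) [MeasurableSpace Ω] (P : Measure Ω) [IsProbabilityMeasure P]
          (g : ℕ → Ω → S), IsElephantWalk S p P g →
          ∀ n : ℕ, 2 ≤ n →
            speedErrorMoment P g 2 n ≤ C * (rate d p n ^ (-2 : ℝ) * Real.log n)) ∧
      -- second moment, supercritical regime
      (criticalParam d < p → ∃ C : ℝ, 0 < C ∧
        ∀ (Ω : Type v) [MeasurableSpace Ω] (P : Measure Ω) [IsProbabilityMeasure P]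
          (g : ℕ → Ω → S), IsElephantWalk S p P g →
          ∀ n : ℕ, 1 ≤ n →
            speedErrorMoment P g 2 n ≤ C * rate d p n ^ (-2 : ℝ))) ∧
    -- lower bound near `p = 1 / d`
    (∀ m : ℝ, 1 ≤ m → m < 2 →
      ∃ ε : ℝ, 0 < ε ∧ 0 ≤ 1 / (d : ℝ) - ε ∧ 1 / (d : ℝ) + ε ≤ criticalParam d ∧
        ∀ p : ℝ, 1 / (d : ℝ) - ε < p → p < 1 / (d : ℝ) + ε → ∃ c : ℝ, 0 < c ∧
          ∀ (Ω : Type v) [MeasurableSpace Ω] (P : Measure Ω) [IsProbabilityMeasure P]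
            (g : ℕ → Ω → S), IsElephantWalk S p P g →
            ∀ n : ℕ, 1 ≤ n →
              c * (n : ℝ) ^ (-m / 2) ≤ speedErrorMoment P g m n) := by
  subst hcard
  have hd' : (3 : ℝ) ≤ S.card := by exact_mod_cast hd
  refine ⟨fun p hp0 hp1 => ⟨fun m hm1 hm2 =>
    exists_speedErrorMoment_le hd hS hp0 hp1 (by linarith) hm2.le, fun _ => ?_, fun hp => ?_⟩,
    fun m hm1 _ => ?_⟩
  · obtain ⟨C, hC, h⟩ := exists_speedErrorMoment_le.{v} hd hS hp0 hp1 zero_le_two le_rfl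
    refine ⟨C * 2, by positivity, fun Ω _ P _ g hg n hn => ?_⟩
    have hn' : (2 : ℝ) ≤ n := by exact_mod_cast hn
    have hlog : 1 ≤ 2 * Real.log n := by
      have := Real.log_le_log (by norm_num) hn'
      linarith [Real.log_two_gt_d9]
    have hr := rate_pos (d := S.card) (p := p) (by omega : 1 ≤ n) fun _ => hn
    calc _ ≤ C * rate S.card p n ^ (-2 : ℝ) * 1 := by
          rw [mul_one]
          exact h Ω P g hg n (by omega) fun _ => hn
      _ ≤ C * rate S.card p n ^ (-2 : ℝ) * (2 * Real.log n) := by gcongr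
      _ = _ := by ring
  · obtain ⟨C, hC, h⟩ := exists_speedErrorMoment_le.{v} hd hS hp0 hp1 zero_le_two le_rfl
    exact ⟨C, hC, fun Ω _ P _ g hg n hn =>
      h Ω P g hg n hn fun h => absurd h hp.ne'⟩
  · have hε : 1 / (960 * (S.card : ℝ) ^ 3) ≤ 1 / (6 * S.card) := by
      refine one_div_le_one_div_of_le (by positivity) ?_
      linarith [le_self_pow₀ (show 1 ≤ (S.card : ℝ) by linarith) (show 3 ≠ 0 by norm_num)]
    have h6 : 1 / (6 * (S.card : ℝ)) = 1 / 6 * (1 / S.card) := by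
      rw [one_div_mul_one_div]
    have hc := one_div_card_mem hd
    refine ⟨1 / (960 * (S.card : ℝ) ^ 3), by positivity, by linarith, ?_, fun p hp1 hp2 =>
      ⟨(1 / (40 * (S.card : ℝ) ^ 2)) ^ m, by positivity, fun Ω _ P _ g hg n hn =>
        hg.le_speedErrorMoment hd hS (abs_le.2 ⟨by linarith, by linarith⟩) hm1 hn⟩⟩
    have : criticalParam S.card = 1 / 2 + 1 / 2 * (1 / (S.card : ℝ)) := by
      rw [criticalParam]
      field_simp
    linarith
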